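/- Let $r\ge 2$ and $s,p,n\ge 0$ be integers, and let $T$ be a bicoloured plane tree with passport $[r^2,1^s;4^p;n]$, that is, with $n$ edges, with black vertices of degrees $r,r,1,\dots,1$ ($s$ ones) and with $p$ white vertices, all of degree $4$. Let $\sigma_0$ (resp. $\sigma_1$) be the permutation of the edges of $T$ that sends each edge to the next one in the cyclic order around its black (resp. white) end, and let $G=\langle\sigma_0,\sigma_1\rangle$ be the monodromy group of $T$. Then $T$ has exactly one white vertex, called its center, two of whose four neighbours are black vertices of degree $r$ and the two others black leaves. In the statements below, $N\rtimes Q$ stands for a semidirect product with respect to some action of $Q$ on $N$; $A_p$, $S_p$ are the alternating and symmetric groups of degree $p$, and $\mathbb Z_m$ is the cyclic group of order $m$. (1) If the two leaves adjacent to the center are not consecutive in the cyclic order of the neighbours of the center (the first tree), then $$G\cong\begin{cases}A_p^2\rtimes\mathbb Z_4 & \text{if } r \text{ is odd},\\ S_p^2\rtimes\mathbb Z_4 & \text{if } r \text{ is even}.\end{cases}$$ (2) If the two leaves adjacent to the center are consecutive in that cyclic order (the second tree), then $$G\cong\begin{cases}A_p^4\rtimes\mathbb Z_4 & \text{if } r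 \text{ is odd},\\ A_p^4\rtimes(\mathbb Z_2^3\rtimes\mathbb Z_4) & \text{if } r \text{ is even}.\end{cases}$$ -/

import Mathlib

/-- The bipartite graph with black vertices `B`, white vertices `W`, and one edge joining
`black e` to `white e` for each `e : E`. -/
def bicolouredGraph {E B W : Type*} (black : E → B) (white : E → W) : SimpleGraph (B ⊕ W) where
  Adj x y :=
    (∃ e, x = Sum.inl (black e) ∧ y = Sum.inr (white e)) ∨
      (∃ e, y = Sum.inl (black e) ∧ x = Sum.inr (white e))
  symm := ⟨fun _ _ h => h.symm⟩
  loopless := ⟨by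
    rintro x (⟨e, h₁, h₂⟩ | ⟨e, h₁, h₂⟩) <;> exact absurd (h₁.symm.trans h₂) (by simp)⟩

/-- A bicoloured plane tree with edges `E`, black vertices `B` and white vertices `W`.
The embedding in the plane is given, up to isotopy, by the cyclic order of the edges around
each vertex: `σ₀ e` (resp. `σ₁ e`) is the edge following `e` around its black (resp. white) end. -/
structure BicolouredPlaneTree (E B W : Type*) where
  /-- the black end of an edge -/
  black : E → B
  /-- the white end of an edge -/
  white : E → W
  /-- there are no multiple edges -/
  ends_injective : Function.Injective fun e => (black e, white e)
  isTree : (bicolouredGraph black white).IsTree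
  /-- the rotation of the edges around the black vertices -/
  σ₀ : Equiv.Perm E
  /-- the rotation of the edges around the white vertices -/
  σ₁ : Equiv.Perm E
  /-- the cycles of `σ₀` (fixed points included) are the sets of edges at the black vertices -/
  sameCycle_σ₀ : ∀ e f, σ₀.SameCycle e f ↔ black e = black f
  /-- the cycles of `σ₁` (fixed points included) are the sets of edges at the white vertices -/
  sameCycle_σ₁ : ∀ e f, σ₁.SameCycle e f ↔ white e = white f

namespace BicolouredPlaneTree

variable {E B W : Type*} (T : BicolouredPlaneTree E B W)

/-- The degree of a black vertex. -/
noncomputable def blackDegree (b : B) : ℕ := Nat.card {e : E // T.black e = b}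

/-- The degree of a white vertex. -/
noncomputable def whiteDegree (w : W) : ℕ := Nat.card {e : E // T.white e = w}

/-- `T` has passport `[α; β; n]`: it has `n` edges, the degrees of its black vertices form the
multiset `α`, and the degrees of its white vertices form the multiset `β`. -/
def HasPassport [Fintype E] [Fintype B] [Fintype W] (α β : Multiset ℕ) (n : ℕ) : Prop :=
  Fintype.card E = n ∧
    (Finset.univ : Finset B).val.map T.blackDegree = α ∧
    (Finset.univ : Finset W).val.map T.whiteDegree = β

/-- The monodromy (cartographic) group `⟨σ₀, σ₁⟩`, as a group of permutations of the edges. -/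
def monodromyGroup : Subgroup (Equiv.Perm E) := Subgroup.closure {T.σ₀, T.σ₁}

/-- The white vertex `c` has degree four, two of its neighbours being black vertices of degree `r`
and the two others being black leaves. (As there are no multiple edges, the edges at `c` correspond
to the neighbours of `c`; the notion is meant for `2 ≤ r`.) -/
def IsCenter (r : ℕ) (c : W) : Prop :=
  T.whiteDegree c = 4 ∧
    Nat.card {e : E // T.white e = c ∧ T.blackDegree (T.black e) = r} = 2 ∧
    Nat.card {e : E // T.white e = c ∧ T.blackDegree (T.black e) = 1} = 2

/-- Two black leaves are consecutive in the cyclic order of the neighbours of `c`. -/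
def HasConsecutiveLeaves (c : W) : Prop :=
  ∃ e, T.white e = c ∧ T.blackDegree (T.black e) = 1 ∧ T.blackDegree (T.black (T.σ₁ e)) = 1

end BicolouredPlaneTree

/-- `G` is a semidirect product `N ⋊ Q`, for some action of `Q` on `N`. -/
def IsSemidirectProduct (G N Q : Type*) [Group G] [Group N] [Group Q] : Prop :=
  ∃ φ : Q →* MulAut N, Nonempty (G ≃* SemidirectProduct N Q φ)

/-- The alternating group of degree `p`. -/
abbrev Alt (p : ℕ) : Type := alternatingGroup (Fin p)

/-- The symmetric group of degree `p`. -/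
abbrev Symm (p : ℕ) : Type := Equiv.Perm (Fin p)

/-- The cyclic group of order `m` (for `0 < m`), written multiplicatively. -/
abbrev Cyc (m : ℕ) : Type := Multiplicative (ZMod m)

open Equiv Equiv.Perm MulAction
open scoped Pointwise

/-! Let `x`, `y` be the black vertices of degree `r`; all other black vertices are leaves.
Connectedness makes every white vertex a neighbour of `x` or `y` and gives one common neighbour;
acyclicity makes it unique. It is the center `c`.

Number the four edges around each white vertex by `ZMod 4`, with edges at `x` in position `0` and
edges at `y` in position `k`, where `k` is the offset between these two edges at `c`
(`exists_coordinates`). Edges become pairs in `W × ZMod 4`. Then `σ₁` is the shift of the second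
factor, and `σ₀` acts on fibre `0` by an `r`-cycle `a`, on fibre `k` by an `r`-cycle `b`, and
trivially elsewhere, since it fixes edges at leaves. The cycles `a`, `b` cover `W` and share only
`c`. Hence the monodromy group is `P ⋊ Z₄`, where `P` is the least shift-invariant group of families
`ZMod 4 → Perm W` containing `γ = pairAt k a b` (`closure_eq_sup`).

The group `⟨a, b⟩` is primitive and the commutator of `a` and `b` is a 3-cycle, so it contains the
alternating group by Jordan's theorem; it equals it for odd `r` and is the full symmetric group for
even `r`.

If `k = 2`, an involution `τ` exchanges `a` and `b`, so entries of `P` at distance two are tied by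
conjugation by `τ` and `P ≅ ⟨a, b⟩²`. If `k = 1`, `γ` and its shift overlap in one fibre; their
commutator is a 3-cycle in that fibre alone, which frees the fibres, and `P` contains `A_p⁴`. For
odd `r` that is all of `P`; for even `r`, `P` consists of the families whose signs multiply to `1`,
and transpositions supply a complement `Z₂³`. The case `k = 3` is `k = 1` with `x` and `y`
exchanged. -/

/-- The permutations `a` and `b` are cycles on sets `s` and `t` which cover `α` and meet exactly
in the point `o`. -/
structure CyclesMeetingAt {α : Type*} (a b : Perm α) (s t : Set α) (o : α) : Prop where
  left_isCycleOn : a.IsCycleOn s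
  right_isCycleOn : b.IsCycleOn t
  left_apply_of_notMem : ∀ x, x ∉ s → a x = x
  right_apply_of_notMem : ∀ x, x ∉ t → b x = x
  mem_or_mem : ∀ x, x ∈ s ∨ x ∈ t
  mem_left : o ∈ s
  mem_right : o ∈ t
  eq_of_mem : ∀ x, x ∈ s → x ∈ t → x = o
  left_nontrivial : s.Nontrivial
  right_nontrivial : t.Nontrivial

/-! ### Two cycles sharing one point: primitivity, 3-cycles, an exchanging involution. -/

namespace CyclesMeetingAt

variable {α : Type*} {a b : Perm α} {s t : Set α} {o : α}

theorem symm (h : CyclesMeetingAt a b s t o) : CyclesMeetingAt b a t s o :=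
  ⟨h.right_isCycleOn, h.left_isCycleOn, h.right_apply_of_notMem, h.left_apply_of_notMem,
    fun x => (h.mem_or_mem x).symm, h.mem_right, h.mem_left, fun x hx hy => h.eq_of_mem x hy hx,
    h.right_nontrivial, h.left_nontrivial⟩

theorem right_apply_of_mem (h : CyclesMeetingAt a b s t o) {x : α} (hx : x ∈ s) (hxo : x ≠ o) :
    b x = x :=
  h.right_apply_of_notMem x fun hy => hxo (h.eq_of_mem x hx hy)

theorem isCycle_left (h : CyclesMeetingAt a b s t o) : a.IsCycle :=
  isCycle_iff_exists_isCycleOn.2 ⟨s, h.left_nontrivial, h.left_isCycleOn, fun x hx => by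
    by_contra hs
    exact hx (h.left_apply_of_notMem x hs)⟩

theorem support_left [Fintype α] [DecidableEq α] (h : CyclesMeetingAt a b s t o) :
    (a.support : Set α) = s := by
  ext x
  simp only [Finset.mem_coe, mem_support]
  refine ⟨fun hx => ?_, fun hx => h.left_isCycleOn.apply_ne h.left_nontrivial hx⟩
  by_contra hs
  exact hx (h.left_apply_of_notMem x hs)

theorem sign_left [Fintype α] [DecidableEq α] (h : CyclesMeetingAt a b s t o) :
    sign a = -(-1) ^ s.ncard := by
  rw [h.isCycle_left.sign, ← h.support_left, Set.ncard_coe_finset]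

/-- Each cycle fixes the other's points except `o`, so the commutator moves only `o`, `a o` and `b
o`. -/
theorem commutator_eq [DecidableEq α] (h : CyclesMeetingAt a b s t o) :
    a * b * a⁻¹ * b⁻¹ = swap o (b o) * swap o (a o) := by
  have hao : a o ≠ o := h.left_isCycleOn.apply_ne h.left_nontrivial h.mem_left
  have hbo : b o ≠ o := h.right_isCycleOn.apply_ne h.right_nontrivial h.mem_right
  have has : a o ∈ s := h.left_isCycleOn.apply_mem_iff.2 h.mem_left
  have hbt : b o ∈ t := h.right_isCycleOn.apply_mem_iff.2 h.mem_right
  have hab : a o ≠ b o := fun e => hao (h.eq_of_mem _ has (e ▸ hbt))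
  rw [mul_inv_eq_iff_eq_mul, mul_inv_eq_iff_eq_mul]
  ext x
  simp only [Perm.mul_apply]
  by_cases hxo : x = o
  · subst hxo
    rw [h.symm.right_apply_of_mem hbt hbo, h.right_apply_of_mem has hao,
      swap_apply_right, swap_apply_left]
  rcases h.mem_or_mem x with hx | hx
  · rw [h.right_apply_of_mem hx hxo]
    have hax : a x ∈ s := h.left_isCycleOn.apply_mem_iff.2 hx
    by_cases hxo' : a x = o
    · rw [hxo', swap_apply_of_ne_of_ne hbo hab.symm, swap_apply_right]
    · have h1 : a x ≠ a o := fun e => hxo (a.injective e)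
      have h2 : a x ≠ b o := fun e => hbo (h.eq_of_mem _ (e ▸ hax) hbt)
      rw [h.right_apply_of_mem hax hxo', swap_apply_of_ne_of_ne hxo' h1,
        swap_apply_of_ne_of_ne hxo' h2]
  · rw [h.symm.right_apply_of_mem hx hxo]
    have hbx : b x ∈ t := h.right_isCycleOn.apply_mem_iff.2 hx
    by_cases hxo' : b x = o
    · rw [hxo', swap_apply_left, swap_apply_of_ne_of_ne hao hab]
    · have h1 : b x ≠ b o := fun e => hxo (b.injective e)
      have h2 : b x ≠ a o := fun e => hao (h.eq_of_mem _ has (e ▸ hbx))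
      rw [h.symm.right_apply_of_mem hbx hxo', swap_apply_of_ne_of_ne hxo' h2,
        swap_apply_of_ne_of_ne hxo' h1]

theorem isThreeCycle_commutator [Fintype α] [DecidableEq α] (h : CyclesMeetingAt a b s t o) :
    (a * b * a⁻¹ * b⁻¹).IsThreeCycle := by
  have hao : a o ≠ o := h.left_isCycleOn.apply_ne h.left_nontrivial h.mem_left
  have hbo : b o ≠ o := h.right_isCycleOn.apply_ne h.right_nontrivial h.mem_right
  have has : a o ∈ s := h.left_isCycleOn.apply_mem_iff.2 h.mem_left
  have hbt : b o ∈ t := h.right_isCycleOn.apply_mem_iff.2 h.mem_right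
  have hab : a o ≠ b o := fun e => hao (h.eq_of_mem _ has (e ▸ hbt))
  rw [h.commutator_eq]
  exact isThreeCycle_swap_mul_swap_same hbo.symm hao.symm hab.symm

/-- Since `a` fixes the point `y` of the block, it preserves the block, which therefore contains the
whole `a`-orbit of `o`. -/
theorem subset_of_isBlock (h : CyclesMeetingAt a b s t o) {G : Subgroup (Perm α)} (ha : a ∈ G)
    {B : Set α} (hB : IsBlock G B) (ho : o ∈ B) {y : α} (hyB : y ∈ B) (hy : y ∉ s) : s ⊆ B := by
  have hfix : (⟨a, ha⟩ : G) • B = B :=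
    hB.smul_eq_of_mem hyB (by
      change a y ∈ B
      rwa [h.left_apply_of_notMem y hy])
  intro x hx
  obtain ⟨i, rfl⟩ := h.left_isCycleOn.2 h.mem_left hx
  have : (⟨a, ha⟩ : G) ^ i ∈ stabilizer G B := zpow_mem (mem_stabilizer_iff.2 hfix) i
  rw [← mem_stabilizer_iff.1 this]
  exact ⟨o, ho, rfl⟩

/-- A second point in a block through `o` lies off one of the cycles, so that cycle is absorbed; its
points other than `o` lie off the other cycle, which is then absorbed too. -/
theorem isPreprimitive (h : CyclesMeetingAt a b s t o) {G : Subgroup (Perm α)} (ha : a ∈ G)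
    (hb : b ∈ G) : IsPreprimitive G α := by
  have hao : a o ≠ o := h.left_isCycleOn.apply_ne h.left_nontrivial h.mem_left
  refine IsPreprimitive.of_isTrivialBlock_of_notMem_fixedPoints (a := o)
    (fun hf => hao (hf ⟨a, ha⟩)) fun B ho hB => ?_
  by_cases hs : B.Subsingleton
  · exact Or.inl hs
  right
  obtain ⟨y, hyB, hyo⟩ := (Set.not_subsingleton_iff.1 hs).exists_ne o
  have key : s ⊆ B ∧ t ⊆ B := by
    rcases h.mem_or_mem y with hy | hy
    · have ht : t ⊆ B :=
        h.symm.subset_of_isBlock hb hB ho hyB fun hy' => hyo (h.eq_of_mem y hy hy')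
      obtain ⟨z, hz, hzo⟩ := h.right_nontrivial.exists_ne o
      exact ⟨h.subset_of_isBlock ha hB ho (ht hz) fun hz' => hzo (h.eq_of_mem z hz' hz), ht⟩
    · have hs : s ⊆ B :=
        h.subset_of_isBlock ha hB ho hyB fun hy' => hyo (h.eq_of_mem y hy' hy)
      obtain ⟨z, hz, hzo⟩ := h.left_nontrivial.exists_ne o
      exact ⟨hs, h.symm.subset_of_isBlock hb hB ho (hs hz) fun hz' =>
        hzo (h.eq_of_mem z hz hz')⟩
  exact Set.eq_univ_of_forall fun x => (h.mem_or_mem x).elim (@key.1 x) (@key.2 x)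

theorem alternatingGroup_le [Fintype α] [DecidableEq α] (h : CyclesMeetingAt a b s t o)
    {G : Subgroup (Perm α)} (ha : a ∈ G) (hb : b ∈ G) : alternatingGroup α ≤ G :=
  alternatingGroup_le_of_isPreprimitive_of_isThreeCycle_mem (h.isPreprimitive ha hb)
    h.isThreeCycle_commutator
    (mul_mem (mul_mem (mul_mem ha hb) (inv_mem ha)) (inv_mem hb))

theorem closure_eq_alternatingGroup [Fintype α] [DecidableEq α] (h : CyclesMeetingAt a b s t o)
    (hs : Odd s.ncard) (ht : Odd t.ncard) : Subgroup.closure {a, b} = alternatingGroup α := by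
  refine le_antisymm ((Subgroup.closure_le _).2 ?_)
    (h.alternatingGroup_le (Subgroup.subset_closure (by simp)) (Subgroup.subset_closure (by simp)))
  rintro x (rfl | rfl)
  · simp [mem_alternatingGroup, h.sign_left, hs.neg_one_pow]
  · simp [mem_alternatingGroup, h.symm.sign_left, ht.neg_one_pow]

theorem closure_eq_top [Fintype α] [DecidableEq α] (h : CyclesMeetingAt a b s t o)
    (hs : Even s.ncard) : Subgroup.closure {a, b} = ⊤ := by
  have ha : a ∈ Subgroup.closure {a, b} := Subgroup.subset_closure (by simp)
  have hle := h.alternatingGroup_le ha (Subgroup.subset_closure (by simp))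
  refine (Subgroup.eq_top_iff' _).2 fun x => ?_
  rcases Int.units_eq_one_or (sign x) with hx | hx
  · exact hle hx
  · have : x * a ∈ alternatingGroup α := by
      simp [mem_alternatingGroup, hx, h.sign_left, hs.neg_one_pow]
    exact (Subgroup.mul_mem_cancel_right _ ha).1 (hle this)

/-- The involution exchanges `a ^ i o` with `b ^ i o`; equal lengths make this consistent. -/
theorem exists_involution [Finite α] (h : CyclesMeetingAt a b s t o) (hst : s.ncard = t.ncard) :
    ∃ τ : Perm α, τ * τ = 1 ∧ τ * a * τ⁻¹ = b := by
  classical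
  have hs : ∀ i j : ℤ, (a ^ i) o = (a ^ j) o ↔ i ≡ j [ZMOD s.ncard] := fun i j => by
    have := (h.left_isCycleOn)
    rw [← s.toFinite.coe_toFinset] at this
    rw [Set.ncard_eq_toFinset_card s]
    exact this.zpow_apply_eq_zpow_apply (by simpa using h.mem_left)
  have ht : ∀ i j : ℤ, (b ^ i) o = (b ^ j) o ↔ i ≡ j [ZMOD t.ncard] := fun i j => by
    have := (h.right_isCycleOn)
    rw [← t.toFinite.coe_toFinset] at this
    rw [Set.ncard_eq_toFinset_card t]
    exact this.zpow_apply_eq_zpow_apply (by simpa using h.mem_right)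
  have hex : ∀ x, ∃ y, ∃ i : ℤ, (x = (a ^ i) o ∧ y = (b ^ i) o) ∨
      (x = (b ^ i) o ∧ y = (a ^ i) o) := fun x => by
    rcases h.mem_or_mem x with hx | hx
    · obtain ⟨i, hi⟩ := h.left_isCycleOn.2 h.mem_left hx
      exact ⟨_, i, Or.inl ⟨hi.symm, rfl⟩⟩
    · obtain ⟨i, hi⟩ := h.right_isCycleOn.2 h.mem_right hx
      exact ⟨_, i, Or.inr ⟨hi.symm, rfl⟩⟩
  choose f hf using hex
  have hsm : ∀ i : ℤ, (a ^ i) o ∈ s := fun i =>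
    (h.left_isCycleOn.1.perm_zpow i).mapsTo h.mem_left
  have htm : ∀ i : ℤ, (b ^ i) o ∈ t := fun i =>
    (h.right_isCycleOn.1.perm_zpow i).mapsTo h.mem_right
  -- The two orbits meet only at `o`, so a coincidence forces both exponents to vanish modulo the
  -- common length.
  have hmix : ∀ i j : ℤ, (a ^ i) o = (b ^ j) o → (a ^ j) o = (b ^ i) o := fun i j e => by
    have h1 : (a ^ i) o = o := h.eq_of_mem _ (hsm i) (e ▸ htm j)
    have h2 : (a ^ i) o = (a ^ (0 : ℤ)) o := by simpa using h1
    have h3 : (b ^ j) o = (b ^ (0 : ℤ)) o := by simpa using e.symm.trans h1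
    rw [(hs j 0).2 (hst ▸ (ht j 0).1 h3), (ht i 0).2 (hst ▸ (hs i 0).1 h2)]
    simp
  have hfa : ∀ i : ℤ, f ((a ^ i) o) = (b ^ i) o := fun i => by
    obtain ⟨j, ⟨h1, h2⟩ | ⟨h1, h2⟩⟩ := hf ((a ^ i) o)
    · rw [h2, (ht j i).2 (hst ▸ ((hs i j).1 h1).symm)]
    · rw [h2, hmix i j h1]
  have hfb : ∀ i : ℤ, f ((b ^ i) o) = (a ^ i) o := fun i => by
    obtain ⟨j, ⟨h1, h2⟩ | ⟨h1, h2⟩⟩ := hf ((b ^ i) o)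
    · rw [h2, hmix j i h1.symm]
    · rw [h2, (hs j i).2 (hst ▸ ((ht i j).1 h1).symm)]
  have hinv : Function.Involutive f := fun x => by
    obtain ⟨i, ⟨h1, h2⟩ | ⟨h1, h2⟩⟩ := hf x
    · rw [h2, hfb, h1]
    · rw [h2, hfa, h1]
  refine ⟨hinv.toPerm, by ext x; exact hinv x, ?_⟩
  rw [mul_inv_eq_iff_eq_mul]
  ext x
  change f (a x) = b (f x)
  have hstep : ∀ i : ℤ, f (a ((a ^ i) o)) = b (f ((a ^ i) o)) := fun i => by
    rw [← Perm.mul_apply a, ← zpow_one_add, hfa, hfa, zpow_one_add, Perm.mul_apply]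
  rcases h.mem_or_mem x with hx | hx
  · obtain ⟨i, rfl⟩ := h.left_isCycleOn.2 h.mem_left hx
    exact hstep i
  · obtain rfl | hxo := eq_or_ne x o
    · simpa using hstep 0
    obtain ⟨i, rfl⟩ := h.right_isCycleOn.2 h.mem_right hx
    rw [h.symm.right_apply_of_mem hx hxo, hfb, h.right_apply_of_mem (hsm i)]
    intro e
    have h0 : (a ^ i) o = (b ^ (0 : ℤ)) o := by simpa using e
    exact hxo (by simpa using (hmix i 0 h0).symm)

end CyclesMeetingAt

/-- A subgroup of the symmetric group normalized by the alternating group and containing a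
three-cycle contains the alternating group. -/
theorem alternatingGroup_le_of_conj_mem {α : Type*} [Fintype α] [DecidableEq α]
    {S : Subgroup (Perm α)} {c : Perm α} (hc : c.IsThreeCycle) (hcS : c ∈ S)
    (hS : ∀ g ∈ alternatingGroup α, ∀ x ∈ S, g * x * g⁻¹ ∈ S) : alternatingGroup α ≤ S := by
  rw [← closure_three_cycles_eq_alternating, Subgroup.closure_le]
  intro d hd
  obtain ⟨g, rfl⟩ := isConj_iff.1 (isConj_iff_cycleType_eq.2 (hc.cycleType.trans
    (IsThreeCycle.cycleType hd).symm))
  rcases Int.units_eq_one_or (sign g) with hg | hg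
  · exact hS g hg c hcS
  -- An odd conjugator `g` is corrected by a transposition `w` inverting `c`: the even `g * w`
  -- carries `c` to the inverse of the target 3-cycle.
  obtain ⟨w, hw, hwc⟩ : ∃ w : Perm α, sign w = -1 ∧ w * c * w⁻¹ = c⁻¹ := by
    obtain ⟨x, hx⟩ := hc.isCycle.nonempty_support
    refine ⟨swap x (c x), sign_swap (mem_support.1 hx).symm, ?_⟩
    obtain ⟨q, hq, hpq⟩ : ∃ q : Perm α, q * q = 1 ∧ c = swap x (c x) * q :=
      ⟨_, swap_mul_self _ _, hc.eq_swap_mul_swap_iff_mem_support.2 hx⟩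
    have hpc : swap x (c x) * c = q := eq_inv_mul_iff_mul_eq.1 (by rwa [swap_inv])
    rw [hpc, eq_comm, inv_eq_iff_mul_eq_one, ← mul_assoc, mul_inv_eq_one]
    nth_rw 1 [hpq]
    rw [mul_assoc, hq, mul_one]
  have hgw : g * w ∈ alternatingGroup α := by simp [mem_alternatingGroup, hg, hw]
  have := inv_mem (hS _ hgw c hcS)
  rwa [mul_inv_rev g w, mul_assoc, mul_assoc, ← mul_assoc c, ← mul_assoc w, ← mul_assoc w, hwc,
    ← mul_assoc, conj_inv, inv_inv] at this

/-! ### Internal semidirect products. -/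

namespace IsSemidirectProduct

variable {G G' N N' Q Q' : Type*} [Group G] [Group G'] [Group N] [Group N'] [Group Q] [Group Q']

theorem congr (h : IsSemidirectProduct G N Q) (eG : G ≃* G') (eN : N ≃* N') (eQ : Q ≃* Q') :
    IsSemidirectProduct G' N' Q' := by
  obtain ⟨φ, ⟨e⟩⟩ := h
  exact ⟨_, ⟨eG.symm.trans (e.trans (SemidirectProduct.congr' eN eQ))⟩⟩

theorem sup (N Q : Subgroup G) (hQ : Q ≤ Subgroup.normalizer N) (h : Disjoint N Q) :
    IsSemidirectProduct ↥(N ⊔ Q) N Q := by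
  have hinj : Function.Injective (SemidirectProduct.monoidHomSubgroup hQ) := by
    rw [injective_iff_map_eq_one]
    intro x hx
    have hx' : (x.left : G) * (x.right : G) = 1 := hx
    have h1 : (x.right : G) = 1 := by
      refine Subgroup.disjoint_def.1 h ?_ x.right.2
      rw [← inv_eq_of_mul_eq_one_right hx']
      exact inv_mem x.left.2
    have h2 : (x.left : G) = 1 := by simpa [h1] using hx'
    exact SemidirectProduct.ext (Subtype.ext h2) (Subtype.ext h1)
  have hrange : (SemidirectProduct.monoidHomSubgroup hQ).range = N ⊔ Q := by
    refine SetLike.coe_injective ?_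
    rw [Subgroup.coe_mul_of_right_le_normalizer_left N Q hQ]
    ext g
    constructor
    · rintro ⟨x, rfl⟩
      exact Set.mul_mem_mul x.left.2 x.right.2
    · rintro ⟨n, hn, q, hq, rfl⟩
      exact ⟨⟨⟨n, hn⟩, ⟨q, hq⟩⟩, rfl⟩
  exact ⟨_, ⟨(MulEquiv.subgroupCongr hrange).symm.trans (MonoidHom.ofInjective hinj).symm⟩⟩

end IsSemidirectProduct

theorem conj_conj_of_mul_self_eq_one {G : Type*} [Group G] {τ : G} (hτ : τ * τ = 1) (x : G) :
    τ * (τ * x * τ⁻¹) * τ⁻¹ = x := by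
  rw [inv_eq_of_mul_eq_one_right hτ]
  simp only [mul_assoc, hτ, mul_one]
  rw [← mul_assoc, hτ, one_mul]

/-! ### The wreath product with `ZMod 4`, and cycles in opposite fibres. -/

section Wreath

variable {α : Type*}

/-- A family of permutations of `α` indexed by `ZMod 4` acts on `α × ZMod 4` fibrewise. -/
def fibrewisePerm (α : Type*) : (ZMod 4 → Perm α) →* Perm (α × ZMod 4) where
  toFun f :=
    { toFun := fun x => (f x.2 x.1, x.2)
      invFun := fun x => ((f x.2)⁻¹ x.1, x.2)
      left_inv := fun x => by simp
      right_inv := fun x => by simp }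
  map_one' := rfl
  map_mul' _ _ := rfl

@[simp] theorem fibrewisePerm_apply (f : ZMod 4 → Perm α) (x : α × ZMod 4) :
    fibrewisePerm α f x = (f x.2 x.1, x.2) := rfl

theorem fibrewisePerm_injective : Function.Injective (fibrewisePerm α) := fun f g h => by
  ext i x
  simpa using congrArg Prod.fst (DFunLike.congr_fun h (x, i))

/-- The cyclic group of order four acts on `α × ZMod 4` by translations of the second factor. -/
def shiftPerm (α : Type*) : Cyc 4 →* Perm (α × ZMod 4) where
  toFun j :=
    { toFun := fun x => (x.1, x.2 + j.toAdd)
      invFun := fun x => (x.1, x.2 - j.toAdd)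
      left_inv := fun x => by simp
      right_inv := fun x => by simp }
  map_one' := by ext x <;> simp
  map_mul' i j := by ext x <;> simp [add_comm, add_left_comm]

@[simp] theorem shiftPerm_apply (j : Cyc 4) (x : α × ZMod 4) :
    shiftPerm α j x = (x.1, x.2 + j.toAdd) := rfl

theorem shiftPerm_injective [Nonempty α] : Function.Injective (shiftPerm α) := fun i j h => by
  obtain ⟨x⟩ := ‹Nonempty α›
  simpa using congrArg Prod.snd (DFunLike.congr_fun h (x, 0))

theorem shiftPerm_range : (shiftPerm α).range = Subgroup.zpowers (shiftPerm α (Multiplicative.ofAdd 1)) := by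
  have h : (⊤ : Subgroup (Cyc 4)) = Subgroup.zpowers (Multiplicative.ofAdd 1) := by
    refine ((Subgroup.eq_top_iff' _).2 fun j =>
      Subgroup.mem_zpowers_iff.2 ⟨(j.toAdd.val : ℤ), ?_⟩).symm
    rw [← ofAdd_zsmul]
    simp
  rw [MonoidHom.range_eq_map, h, MonoidHom.map_zpowers]

/-- A set of families of permutations is shift invariant if it contains the shift by one position
of each of its elements. -/
def ShiftInvariant (P : Subgroup (ZMod 4 → Perm α)) : Prop :=
  ∀ f ∈ P, (fun i => f (i - 1)) ∈ P

theorem ShiftInvariant.shift {P : Subgroup (ZMod 4 → Perm α)} (hP : ShiftInvariant P)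
    {f : ZMod 4 → Perm α} (hf : f ∈ P) (j : ZMod 4) : (fun i => f (i - j)) ∈ P := by
  obtain ⟨n, rfl⟩ := ZMod.natCast_zmod_surjective j
  induction n with
  | zero => simpa using hf
  | succ n ih => simpa [sub_sub, add_comm] using hP _ ih

theorem shiftPerm_conj (f : ZMod 4 → Perm α) (j : Cyc 4) :
    shiftPerm α j * fibrewisePerm α f * (shiftPerm α j)⁻¹ =
      fibrewisePerm α fun i => f (i - j.toAdd) := by
  rw [mul_inv_eq_iff_eq_mul]
  ext x <;> simp

theorem ShiftInvariant.range_le_normalizer {P : Subgroup (ZMod 4 → Perm α)}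
    (hP : ShiftInvariant P) :
    (shiftPerm α).range ≤ Subgroup.normalizer (P.map (fibrewisePerm α) : Set _) := by
  rintro _ ⟨j, rfl⟩
  rw [Subgroup.mem_normalizer_iff]
  have key : ∀ j g, g ∈ P.map (fibrewisePerm α) →
      shiftPerm α j * g * (shiftPerm α j)⁻¹ ∈ P.map (fibrewisePerm α) := by
    rintro j _ ⟨f, hf, rfl⟩
    rw [shiftPerm_conj]
    exact Subgroup.mem_map_of_mem _ (hP.shift hf _)
  refine fun g => ⟨key j g, fun hg => ?_⟩
  simpa [mul_assoc] using key j⁻¹ _ hg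

theorem disjoint_map_shiftPerm_range [Nonempty α] (P : Subgroup (ZMod 4 → Perm α)) :
    _root_.Disjoint (P.map (fibrewisePerm α)) (shiftPerm α).range := by
  obtain ⟨x⟩ := ‹Nonempty α›
  rw [Subgroup.disjoint_def]
  rintro _ ⟨f, -, rfl⟩ ⟨j, hj⟩
  have : j.toAdd = 0 := by simpa using congrArg Prod.snd (DFunLike.congr_fun hj (x, 0))
  rw [← hj, toAdd_eq_zero.1 this, map_one]

/-- Conjugation by the shift permutation translates families, so the families lying in the closure
form a shift-invariant subgroup containing `γ`; `hmin` then places `P` inside it. -/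
theorem closure_eq_sup {P : Subgroup (ZMod 4 → Perm α)} {γ : ZMod 4 → Perm α} (hγ : γ ∈ P)
    (hmin : ∀ P' : Subgroup (ZMod 4 → Perm α), γ ∈ P' →
      ShiftInvariant P' → P ≤ P') :
    Subgroup.closure {fibrewisePerm α γ, shiftPerm α (Multiplicative.ofAdd 1)} =
      P.map (fibrewisePerm α) ⊔ (shiftPerm α).range := by
  refine le_antisymm ((Subgroup.closure_le _).2 ?_) (sup_le ?_ ?_)
  · rintro _ (rfl | rfl)
    · exact Subgroup.mem_sup_left (Subgroup.mem_map_of_mem _ hγ)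
    · exact Subgroup.mem_sup_right ⟨_, rfl⟩
  · rw [Subgroup.map_le_iff_le_comap]
    refine hmin _ (Subgroup.subset_closure (by simp)) fun f hf => ?_
    have hrot : shiftPerm α (Multiplicative.ofAdd 1) ∈
        Subgroup.closure {fibrewisePerm α γ, shiftPerm α (Multiplicative.ofAdd 1)} :=
      Subgroup.subset_closure (by simp)
    have := mul_mem (mul_mem hrot hf) (inv_mem hrot)
    rwa [shiftPerm_conj] at this
  · rw [shiftPerm_range, Subgroup.zpowers_le]
    exact Subgroup.subset_closure (by simp)

theorem isSemidirectProduct_sup_shiftPerm [Nonempty α] {P : Subgroup (ZMod 4 → Perm α)}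
    (hP : ShiftInvariant P) :
    IsSemidirectProduct ↥(P.map (fibrewisePerm α) ⊔ (shiftPerm α).range) P (Cyc 4) :=
  (IsSemidirectProduct.sup _ _ hP.range_le_normalizer (disjoint_map_shiftPerm_range P)).congr
    (MulEquiv.refl _) (P.equivMapOfInjective _ fibrewisePerm_injective).symm
    (MonoidHom.ofInjective shiftPerm_injective).symm

/-- The families of permutations whose entries lie in `H` and such that entries at distance two
are conjugate under `τ`. -/
def twistedDiagonal (H : Subgroup (Perm α)) (τ : Perm α) : Subgroup (ZMod 4 → Perm α) where
  carrier := {f | (∀ i, f i ∈ H) ∧ ∀ i, f (i + 2) = τ * f i * τ⁻¹}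
  one_mem' := ⟨fun _ => one_mem _, fun _ => by simp⟩
  mul_mem' hf hg := ⟨fun i => mul_mem (hf.1 i) (hg.1 i), fun i => by
    simp [hf.2 i, hg.2 i, mul_assoc]⟩
  inv_mem' hf := ⟨fun i => inv_mem (hf.1 i), fun i => by simp [hf.2 i, mul_assoc]⟩

/-- The family with entries `x` in position `0`, `y` in position `k`, and `1` elsewhere. -/
def pairAt (k : ZMod 4) (x y : Perm α) (i : ZMod 4) : Perm α :=
  if i = 0 then x else if i = k then y else 1

/-- The homomorphism sending `x` to the family with entries `x` and `τ * x * τ⁻¹` in the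
positions `0` and `2`. -/
def oppositePair (τ : Perm α) : Perm α →* (ZMod 4 → Perm α) where
  toFun x := pairAt 2 x (τ * x * τ⁻¹)
  map_one' := by ext1 i; simp [pairAt]
  map_mul' x y := by
    ext1 i
    simp only [pairAt, Pi.mul_apply]
    split_ifs <;> simp [mul_assoc]

theorem twistedDiagonal_shiftInvariant (H : Subgroup (Perm α)) (τ : Perm α) :
    ShiftInvariant (twistedDiagonal H τ) := fun f hf =>
  ⟨fun i => hf.1 _, fun i => by rw [← hf.2, sub_add_eq_add_sub]⟩

theorem pairAt_mem_twistedDiagonal {H : Subgroup (Perm α)} {a b τ : Perm α} (ha : a ∈ H)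
    (hb : b ∈ H) (hτ : τ * τ = 1) (hab : τ * a * τ⁻¹ = b) :
    pairAt 2 a b ∈ twistedDiagonal H τ := by
  have hba : τ * b * τ⁻¹ = a := by
    rw [← hab, conj_conj_of_mul_self_eq_one hτ]
  refine ⟨fun i => ?_, fun i => ?_⟩
  · simp only [pairAt]
    split_ifs
    exacts [ha, hb, one_mem _]
  · have h20 : (2 : ZMod 4) ≠ 0 := by decide
    have h22 : (2 : ZMod 4) + 2 = 0 := by decide
    obtain rfl | h0 := eq_or_ne i 0
    · simp [pairAt, h20, hab]
    obtain rfl | h2 := eq_or_ne i 2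
    · simp [pairAt, h20, h22, hba]
    · have h0' : i + 2 ≠ 0 := fun h => h2 (add_right_cancel (h.trans h22.symm))
      have h2' : i + 2 ≠ 2 := by simpa using h0
      simp [pairAt, h0, h2, h0']

/-- The preimage of `P` under `oppositePair τ` contains `a` through `γ`, and `b` through `γ` shifted
by two, hence all of `⟨a, b⟩`. A twisted family is the product of an opposite pair in positions `0`,
`2` and a shifted one in positions `1`, `3`. -/
theorem twistedDiagonal_le {a b τ : Perm α} (hτ : τ * τ = 1) (hab : τ * a * τ⁻¹ = b)
    {P : Subgroup (ZMod 4 → Perm α)} (hγ : pairAt 2 a b ∈ P) (hP : ShiftInvariant P) :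
    twistedDiagonal (Subgroup.closure {a, b}) τ ≤ P := by
  have hba : τ * b * τ⁻¹ = a := by
    rw [← hab, conj_conj_of_mul_self_eq_one hτ]
  have hle : Subgroup.closure {a, b} ≤ P.comap (oppositePair τ) := by
    rw [Subgroup.closure_le]
    rintro _ (rfl | rfl)
    · change pairAt 2 _ _ ∈ P
      rwa [hab]
    · change pairAt 2 _ _ ∈ P
      rw [hba]
      convert hP.shift hγ 2 using 1
      ext1 i
      have h20 : (2 : ZMod 4) ≠ 0 := by decide
      have h22 : i - 2 = 2 ↔ i = 0 := by rw [sub_eq_iff_eq_add]; rfl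
      simp only [pairAt, sub_eq_zero, h22]
      split_ifs with h1 h2
      · exact absurd (h2.symm.trans h1) h20
      all_goals rfl
  intro f hf
  have h0 : oppositePair τ (f 0) ∈ P := hle (hf.1 0)
  have h1 : oppositePair τ (f 1) ∈ P := hle (hf.1 1)
  convert mul_mem h0 (hP.shift h1 1) using 1
  ext1 i
  have e2 : f 2 = τ * f 0 * τ⁻¹ := hf.2 0
  have e3 : f 3 = τ * f 1 * τ⁻¹ := hf.2 1
  have d : ∀ i : ZMod 4, i = 0 ∨ i = 1 ∨ i = 2 ∨ i = 3 := by decide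
  have n1 : (2 : ZMod 4) ≠ 0 := by decide
  have n2 : (3 : ZMod 4) ≠ 0 := by decide
  have n3 : (3 : ZMod 4) ≠ 2 := by decide
  have n4 : (1 : ZMod 4) ≠ 2 := by decide
  have n5 : (-1 : ZMod 4) ≠ 2 := by decide
  have n6 : (3 : ZMod 4) - 1 = 2 := by decide
  have n7 : (2 : ZMod 4) - 1 = 1 := by decide
  have n8 : (1 : ZMod 4) ≠ 0 := by decide
  rcases d i with rfl | rfl | rfl | rfl <;>
    simp [oppositePair, pairAt, e2, e3, n1, n2, n3, n4, n5, n6, n7, n8]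

/-- A family in `twistedDiagonal H τ` is determined by its entries in the positions `0`, `1`. -/
noncomputable def twistedDiagonalEquiv (H : Subgroup (Perm α)) {τ : Perm α} (hτ : τ * τ = 1)
    (hH : ∀ x ∈ H, τ * x * τ⁻¹ ∈ H) : twistedDiagonal H τ ≃* (Fin 2 → H) :=
  MulEquiv.ofBijective
    ({ toFun := fun f j => ⟨f.1 (j : ℕ), f.2.1 _⟩
       map_one' := rfl
       map_mul' := fun _ _ => rfl } : twistedDiagonal H τ →* (Fin 2 → H)) <| by
    constructor
    · intro f g h
      have h0 : f.1 0 = g.1 0 := congrArg Subtype.val (congrFun h 0)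
      have h1 : f.1 1 = g.1 1 := congrArg Subtype.val (congrFun h 1)
      have h2 : f.1 2 = g.1 2 := (f.2.2 0).trans (h0 ▸ (g.2.2 0).symm)
      have h3 : f.1 3 = g.1 3 := (f.2.2 1).trans (h1 ▸ (g.2.2 1).symm)
      have d : ∀ i : ZMod 4, i = 0 ∨ i = 1 ∨ i = 2 ∨ i = 3 := by decide
      ext1
      ext1 i
      rcases d i with rfl | rfl | rfl | rfl <;> assumption
    · intro u
      let v : ZMod 4 → Perm α :=
        ![(u 0 : Perm α), u 1, τ * u 0 * τ⁻¹, τ * u 1 * τ⁻¹]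
      have d : ∀ i : ZMod 4, i = 0 ∨ i = 1 ∨ i = 2 ∨ i = 3 := by decide
      refine ⟨⟨v, fun i => ?_, fun i => ?_⟩, ?_⟩
      · rcases d i with rfl | rfl | rfl | rfl
        exacts [(u 0).2, (u 1).2, hH _ (u 0).2, hH _ (u 1).2]
      · rcases d i with rfl | rfl | rfl | rfl
        exacts [rfl, rfl, (conj_conj_of_mul_self_eq_one hτ _).symm, (conj_conj_of_mul_self_eq_one hτ _).symm]
      · ext1 j
        fin_cases j <;> rfl

end Wreath

/-- The group generated by the fibrewise action of two cycles meeting in one point, placed in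
opposite fibres, and by the shift. -/
theorem CyclesMeetingAt.isSemidirectProduct_closure_pairAt_two {α : Type*} [Finite α]
    {a b : Perm α} {s t : Set α} {o : α} (h : CyclesMeetingAt a b s t o)
    (hst : s.ncard = t.ncard) :
    IsSemidirectProduct (Subgroup.closure {fibrewisePerm α (pairAt 2 a b),
      shiftPerm α (Multiplicative.ofAdd 1)}) (Fin 2 → Subgroup.closure {a, b}) (Cyc 4) := by
  obtain ⟨τ, hτ, hab⟩ := h.exists_involution hst
  have : Nonempty α := ⟨o⟩
  have hba : τ * b * τ⁻¹ = a := by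
    rw [← hab, conj_conj_of_mul_self_eq_one hτ]
  have ha : a ∈ Subgroup.closure {a, b} := Subgroup.subset_closure (by simp)
  have hb : b ∈ Subgroup.closure {a, b} := Subgroup.subset_closure (by simp)
  have hH : Subgroup.closure {a, b} ≤ (Subgroup.closure {a, b}).comap
      (MulAut.conj τ).toMonoidHom := by
    rw [Subgroup.closure_le]
    rintro _ (rfl | rfl)
    · simpa [hab] using hb
    · simpa [hba] using ha
  rw [closure_eq_sup (pairAt_mem_twistedDiagonal ha hb hτ hab)
    fun P' h₁ h₂ => twistedDiagonal_le hτ hab h₁ h₂]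
  exact (isSemidirectProduct_sup_shiftPerm (twistedDiagonal_shiftInvariant _ _)).congr
    (MulEquiv.refl _) (twistedDiagonalEquiv _ hτ fun x hx => by simpa using hH hx)
    (MulEquiv.refl _)

/-! ### Cycles in consecutive fibres: families of even permutations and sign conditions. -/

section SignProduct

variable {α : Type*} [Fintype α] [DecidableEq α]

/-- The families of even permutations. -/
abbrev evenFamilies (α : Type*) [Fintype α] [DecidableEq α] : Subgroup (ZMod 4 → Perm α) :=
  Subgroup.pi Set.univ fun _ => alternatingGroup α

theorem mem_evenFamilies {f : ZMod 4 → Perm α} : f ∈ evenFamilies α ↔ ∀ i, sign (f i) = 1 := by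
  simp [Subgroup.mem_pi, mem_alternatingGroup]

/-- The families in which the number of odd permutations is even. -/
def evenProductFamilies (α : Type*) [Fintype α] [DecidableEq α] : Subgroup (ZMod 4 → Perm α) where
  carrier := {f | ∏ i, sign (f i) = 1}
  one_mem' := by simp
  mul_mem' {f g} hf hg := by
    simp only [Set.mem_ofPred_eq] at hf hg ⊢
    simp [Finset.prod_mul_distrib, hf, hg]
  inv_mem' {f} hf := by
    simp only [Set.mem_ofPred_eq] at hf ⊢
    simp [hf]

theorem mem_evenProductFamilies {f : ZMod 4 → Perm α} :
    f ∈ evenProductFamilies α ↔ ∏ i, sign (f i) = 1 := Iff.rfl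

theorem mem_evenProductFamilies' {f : ZMod 4 → Perm α} : f ∈ evenProductFamilies α ↔
    sign (f 0) * sign (f 1) * sign (f 2) * sign (f 3) = 1 := by
  rw [mem_evenProductFamilies]
  exact iff_of_eq (congrArg (· = 1) (Fin.prod_univ_four fun i => sign (f i)))

theorem pairAt_one_mem_evenProductFamilies {x y : Perm α} (hxy : sign x * sign y = 1) :
    pairAt 1 x y ∈ evenProductFamilies α := by
  have n1 : (2 : ZMod 4) ≠ 0 := by decide
  have n2 : (3 : ZMod 4) ≠ 0 := by decide
  have n3 : (3 : ZMod 4) ≠ 1 := by decide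
  have n4 : (2 : ZMod 4) ≠ 1 := by decide
  have n10 : (1 : ZMod 4) ≠ 0 := by decide
  rw [mem_evenProductFamilies']
  simp [pairAt, n10, n1, n2, n3, n4, hxy]

theorem evenFamilies_shiftInvariant : ShiftInvariant (evenFamilies α) := fun f hf => by
  rw [mem_evenFamilies] at hf ⊢
  exact fun i => hf _

theorem evenProductFamilies_shiftInvariant : ShiftInvariant (evenProductFamilies α) :=
  fun f hf => by
    rw [mem_evenProductFamilies] at hf ⊢
    rw [← hf]
    exact (Equiv.subRight (1 : ZMod 4)).prod_comp fun i => sign (f i)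

/-- The families of even permutations form a direct power of the alternating group. -/
def evenFamiliesEquiv (α : Type*) [Fintype α] [DecidableEq α] :
    evenFamilies α ≃* (Fin 4 → alternatingGroup α) where
  toFun f i := ⟨f.1 i, f.2 i trivial⟩
  invFun f := ⟨fun i => f i, fun i _ => (f i).2⟩
  left_inv _ := rfl
  right_inv _ := rfl
  map_mul' _ _ := rfl

theorem evenFamilies_le_normalizer (P : Subgroup (ZMod 4 → Perm α)) :
    P.map (fibrewisePerm α) ≤
      Subgroup.normalizer ((evenFamilies α).map (fibrewisePerm α) : Set _) := by
  have : (evenFamilies α).Normal := ⟨fun f hf g => by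
    rw [mem_evenFamilies] at hf ⊢
    simp [hf]⟩
  have h := Subgroup.le_normalizer_map (H := evenFamilies α) (fibrewisePerm α)
  rw [Subgroup.normalizer_eq_top] at h
  exact (Subgroup.map_mono le_top).trans h

namespace CyclesMeetingAt

variable {a b : Perm α} {s t : Set α} {o : α}

/-- The families `(1, a, b, 1)` and `(a, b, 1, 1)` overlap only in position `1`, so their commutator
is a 3-cycle supported there. The group `S` of entries that `P` admits in position `1` alone is
normalized by `a` and `b`, hence by the alternating group, and so contains it; shifts reach the
other positions. -/
theorem evenFamilies_le (h : CyclesMeetingAt a b s t o) {P : Subgroup (ZMod 4 → Perm α)}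
    (hγ : pairAt 1 a b ∈ P) (hP : ShiftInvariant P) : evenFamilies α ≤ P := by
  have n10 : (1 : ZMod 4) ≠ 0 := by decide
  have hγ' := hP.shift hγ 1
  have hb1 : pairAt 1 a b 1 = b := by simp [pairAt, n10]
  have ha1 : (fun i => pairAt 1 a b (i - 1)) 1 = a := by simp [pairAt]
  set S := P.comap (MonoidHom.mulSingle (fun _ : ZMod 4 => Perm α) 1) with hS
  have hconj : ∀ f ∈ P, ∀ x : Perm α, f * Pi.mulSingle 1 x * f⁻¹ =
      Pi.mulSingle (1 : ZMod 4) (f 1 * x * (f 1)⁻¹) := fun f _ x => by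
    ext1 i
    obtain rfl | hi := eq_or_ne i 1
    · simp
    · simp [hi]
  have hnorm : ∀ f ∈ P, f 1 ∈ Subgroup.normalizer (S : Set (Perm α)) := fun f hf => by
    refine Subgroup.mem_normalizer_fintype fun x hx => ?_
    change Pi.mulSingle 1 _ ∈ P
    rw [← hconj f hf]
    exact mul_mem (mul_mem hf hx) (inv_mem hf)
  have hcomm : a * b * a⁻¹ * b⁻¹ ∈ S := by
    change Pi.mulSingle 1 _ ∈ P
    convert mul_mem (mul_mem (mul_mem hγ' hγ) (inv_mem hγ')) (inv_mem hγ) using 1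
    ext1 i
    have d : ∀ i : ZMod 4, i = 0 ∨ i = 1 ∨ i = 2 ∨ i = 3 := by decide
    have n1 : (2 : ZMod 4) ≠ 0 := by decide
    have n2 : (3 : ZMod 4) ≠ 0 := by decide
    have n3 : (3 : ZMod 4) ≠ 1 := by decide
    have n4 : (2 : ZMod 4) ≠ 1 := by decide
    have n5 : (-1 : ZMod 4) ≠ 1 := by decide
    have n6 : (3 : ZMod 4) - 1 = 2 := by decide
    have n7 : (2 : ZMod 4) - 1 = 1 := by decide
    rcases d i with rfl | rfl | rfl | rfl <;>
      simp [pairAt, n10, n1, n2, n3, n4, n5, n6, n7, n10.symm]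
  have hle := h.alternatingGroup_le (ha1 ▸ hnorm _ hγ') (hb1 ▸ hnorm _ hγ)
  have hAS : alternatingGroup α ≤ S :=
    alternatingGroup_le_of_conj_mem h.isThreeCycle_commutator hcomm fun g hg x hx =>
      (Subgroup.mem_normalizer_iff.1 (hle hg) x).1 hx
  rw [Subgroup.pi_le_iff]
  rintro i _ ⟨x, hx, rfl⟩
  convert hP.shift (hAS hx : Pi.mulSingle 1 x ∈ P) (i - 1) using 1
  ext1 j
  simp only [MonoidHom.mulSingle_apply, Pi.mulSingle_apply]
  have : j - (i - 1) = 1 ↔ j = i := by rw [sub_eq_iff_eq_add]; simp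
  simp [this]

/-- Multiplying by the shift of `γ` by `j` flips the signs in positions `j` and `j + 1`. This clears
positions `0`, `1`, `2` in turn; the product condition settles position `3`, leaving an even family.
-/
theorem evenProductFamilies_le (h : CyclesMeetingAt a b s t o) (hs : Even s.ncard)
    (ht : Even t.ncard) {P : Subgroup (ZMod 4 → Perm α)} (hγ : pairAt 1 a b ∈ P)
    (hP : ShiftInvariant P) : evenProductFamilies α ≤ P := by
  have hle := h.evenFamilies_le hγ hP
  have hsa : sign a = -1 := by simp [h.sign_left, hs.neg_one_pow]
  have hsb : sign b = -1 := by simp [h.symm.sign_left, ht.neg_one_pow]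
  have d : ∀ i : ZMod 4, i = 0 ∨ i = 1 ∨ i = 2 ∨ i = 3 := by decide
  have hγE : pairAt 1 a b ∈ evenProductFamilies α :=
    pairAt_one_mem_evenProductFamilies (by simp [hsa, hsb])
  have step : ∀ (j : ZMod 4) (f : ZMod 4 → Perm α), f ∈ evenProductFamilies α →
      ((f * fun i => pairAt 1 a b (i - j)) ∈ evenProductFamilies α →
        (f * fun i => pairAt 1 a b (i - j)) ∈ P) → f ∈ P := fun j f hf h => by
    exact (Subgroup.mul_mem_cancel_right _ (hP.shift hγ j)).1
      (h (mul_mem hf (evenProductFamilies_shiftInvariant.shift hγE j)))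
  have e3 : ∀ f ∈ evenProductFamilies α, sign (f 0) = 1 → sign (f 1) = 1 → sign (f 2) = 1 →
      f ∈ P := fun f hf h0 h1 h2 => by
    rw [mem_evenProductFamilies', h0, h1, h2, one_mul, one_mul, one_mul] at hf
    refine hle (mem_evenFamilies.2 fun i => ?_)
    rcases d i with rfl | rfl | rfl | rfl <;> assumption
  have e2 : ∀ f ∈ evenProductFamilies α, sign (f 0) = 1 → sign (f 1) = 1 → f ∈ P :=
    fun f hf h0 h1 => by
      rcases Int.units_eq_one_or (sign (f 2)) with h2 | h2
      · exact e3 f hf h0 h1 h2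
      · refine step 2 f hf fun hm => e3 _ hm ?_ ?_ ?_
        · have : pairAt 1 a b (0 - 2) = 1 := by
            rw [pairAt, if_neg (by decide), if_neg (by decide)]
          simp [-zero_sub, this, h0]
        · have : pairAt 1 a b (1 - 2) = 1 := by
            rw [pairAt, if_neg (by decide), if_neg (by decide)]
          simp [this, h1]
        · simp [pairAt, h2, hsa]
  have e1 : ∀ f ∈ evenProductFamilies α, sign (f 0) = 1 → f ∈ P := fun f hf h0 => by
    rcases Int.units_eq_one_or (sign (f 1)) with h1 | h1
    · exact e2 f hf h0 h1
    · refine step 1 f hf fun hm => e2 _ hm ?_ ?_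
      · have : pairAt 1 a b (0 - 1) = 1 := by
          rw [pairAt, if_neg (by decide), if_neg (by decide)]
        simp [-zero_sub, this, h0]
      · simp [pairAt, h1, hsa]
  intro f hf
  rcases Int.units_eq_one_or (sign (f 0)) with h0 | h0
  · exact e1 f hf h0
  · refine step 0 f hf fun hm => e1 _ hm ?_
    simp [pairAt, h0, hsa]

/-- The group generated by the fibrewise action of two cycles of odd length meeting in one point,
placed in consecutive fibres, and by the shift. -/
theorem isSemidirectProduct_closure_pairAt_one_of_odd (h : CyclesMeetingAt a b s t o)
    (hs : Odd s.ncard) (ht : Odd t.ncard) :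
    IsSemidirectProduct (Subgroup.closure {fibrewisePerm α (pairAt 1 a b),
      shiftPerm α (Multiplicative.ofAdd 1)}) (Fin 4 → alternatingGroup α) (Cyc 4) := by
  have : Nonempty α := ⟨o⟩
  have hγ : pairAt 1 a b ∈ evenFamilies α := mem_evenFamilies.2 fun i => by
    rw [pairAt]
    split_ifs
    · simp [h.sign_left, hs.neg_one_pow]
    · simp [h.symm.sign_left, ht.neg_one_pow]
    · simp
  rw [closure_eq_sup hγ fun P' h₁ h₂ => h.evenFamilies_le h₁ h₂]
  exact (isSemidirectProduct_sup_shiftPerm evenFamilies_shiftInvariant).congr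
    (MulEquiv.refl _) (evenFamiliesEquiv α) (MulEquiv.refl _)

end CyclesMeetingAt

/-- The families with an even number of entries equal to the transposition `t`, the other entries
being trivial. -/
def swapFamilies (t : Perm α) : Subgroup (ZMod 4 → Perm α) :=
  (Subgroup.pi Set.univ fun _ => Subgroup.zpowers t) ⊓ evenProductFamilies α

theorem swapFamilies_shiftInvariant (t : Perm α) : ShiftInvariant (swapFamilies t) :=
  fun _ hf => ⟨fun _ _ => hf.1 _ trivial, evenProductFamilies_shiftInvariant _ hf.2⟩

theorem Equiv.Perm.IsSwap.mem_zpowers_iff {t x : Perm α} (ht : t.IsSwap) :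
    x ∈ Subgroup.zpowers t ↔ x = 1 ∨ x = t := by
  have h2 : t ^ 2 = 1 := ht.orderOf ▸ pow_orderOf_eq_one t
  constructor
  · rintro ⟨n, rfl⟩
    rcases Int.even_or_odd' n with ⟨k, rfl | rfl⟩
    · left
      change t ^ (2 * k) = 1
      rw [zpow_mul, zpow_ofNat, h2, one_zpow]
    · right
      change t ^ (2 * k + 1) = t
      rw [zpow_add, zpow_mul, zpow_ofNat, h2, one_zpow, one_mul, zpow_one]
  · rintro (rfl | rfl)
    exacts [one_mem _, Subgroup.mem_zpowers _]

theorem Equiv.Perm.IsSwap.eq_of_sign_eq {t x y : Perm α} (ht : t.IsSwap)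
    (hx : x ∈ Subgroup.zpowers t) (hy : y ∈ Subgroup.zpowers t) (h : sign x = sign y) :
    x = y := by
  have h1 : (1 : ℤˣ) ≠ -1 := by decide
  rcases ht.mem_zpowers_iff.1 hx with rfl | rfl <;> rcases ht.mem_zpowers_iff.1 hy with rfl | rfl
  · rfl
  · simp [ht.sign_eq] at h
  · simp [ht.sign_eq] at h
  · rfl

/-- The group `swapFamilies t` is elementary abelian of rank three. -/
noncomputable def swapFamiliesEquiv {t : Perm α} (ht : t.IsSwap) :
    swapFamilies t ≃* (Fin 3 → Subgroup.zpowers t) :=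
  MulEquiv.ofBijective
    ({ toFun := fun f j => ⟨f.1 (j : ℕ), f.2.1 _ trivial⟩
       map_one' := rfl
       map_mul' := fun _ _ => rfl } : swapFamilies t →* (Fin 3 → Subgroup.zpowers t)) <| by
    have d : ∀ i : ZMod 4, i = 0 ∨ i = 1 ∨ i = 2 ∨ i = 3 := by decide
    constructor
    · intro f g h
      have h0 : f.1 0 = g.1 0 := congrArg Subtype.val (congrFun h 0)
      have h1 : f.1 1 = g.1 1 := congrArg Subtype.val (congrFun h 1)
      have h2 : f.1 2 = g.1 2 := congrArg Subtype.val (congrFun h 2)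
      have h3 : f.1 3 = g.1 3 := by
        refine ht.eq_of_sign_eq (f.2.1 _ trivial) (g.2.1 _ trivial) ?_
        have e := (mem_evenProductFamilies'.1 f.2.2).trans (mem_evenProductFamilies'.1 g.2.2).symm
        rw [h0, h1, h2] at e
        exact mul_left_cancel e
      ext1
      ext1 i
      rcases d i with rfl | rfl | rfl | rfl <;> assumption
    · intro u
      -- The last entry is the product of the others, so the product of all signs is a square in
      -- `ℤˣ`.
      let v : ZMod 4 → Perm α :=
        ![(u 0 : Perm α), u 1, u 2, u 0 * u 1 * u 2]
      refine ⟨⟨v, fun i _ => ?_, ?_⟩, ?_⟩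
      · rcases d i with rfl | rfl | rfl | rfl
        exacts [(u 0).2, (u 1).2, (u 2).2, mul_mem (mul_mem (u 0).2 (u 1).2) (u 2).2]
      · refine mem_evenProductFamilies'.2 ?_
        change sign (u 0).1 * sign (u 1).1 * sign (u 2).1 *
          sign ((u 0).1 * (u 1).1 * (u 2).1) = 1
        rw [map_mul, map_mul, Int.units_mul_self]
      · ext1 j
        fin_cases j <;> rfl

theorem evenFamilies_sup_swapFamilies {t : Perm α} (ht : t.IsSwap) :
    evenFamilies α ⊔ swapFamilies t = evenProductFamilies α := by
  refine le_antisymm (sup_le (fun f hf => ?_) inf_le_right) fun f hf => ?_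
  · rw [mem_evenFamilies] at hf
    simp [mem_evenProductFamilies, hf]
  -- The family `k` has the signs of `f` with entries `1` and `t`, so `f * k⁻¹` is even.
  · let k : ZMod 4 → Perm α := fun i => if sign (f i) = 1 then 1 else t
    have hk : ∀ i, sign (k i) = sign (f i) := fun i => by
      simp only [k]
      split_ifs with h
      · simp [h]
      · rw [ht.sign_eq, (Int.units_eq_one_or _).resolve_left h]
    rw [← inv_mul_cancel_right f k]
    refine mul_mem (Subgroup.mem_sup_left (mem_evenFamilies.2 fun i => ?_))
      (Subgroup.mem_sup_right ⟨fun i _ => ?_, ?_⟩)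
    · simp [hk]
    · change (if sign (f i) = 1 then 1 else t) ∈ Subgroup.zpowers t
      split_ifs
      exacts [one_mem _, Subgroup.mem_zpowers _]
    · change ∏ i, sign (k i) = 1
      simpa only [hk] using mem_evenProductFamilies.1 hf

theorem disjoint_evenFamilies_swapFamilies {t : Perm α} (ht : t.IsSwap) {f : ZMod 4 → Perm α}
    (hf : f ∈ evenFamilies α) (hf' : f ∈ swapFamilies t) : f = 1 := by
  ext1 i
  exact ht.eq_of_sign_eq (hf'.1 i trivial) (one_mem _) (by simpa using mem_evenFamilies.1 hf i)

/-- The group generated by the fibrewise action of two cycles of even length meeting in one point,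
placed in consecutive fibres, and by the shift. -/
theorem CyclesMeetingAt.isSemidirectProduct_closure_pairAt_one_of_even {a b : Perm α}
    {s t : Set α} {o : α} (h : CyclesMeetingAt a b s t o) (hs : Even s.ncard)
    (ht : Even t.ncard) :
    ∃ ψ : Cyc 4 →* MulAut (Fin 3 → Cyc 2), IsSemidirectProduct
      (Subgroup.closure {fibrewisePerm α (pairAt 1 a b), shiftPerm α (Multiplicative.ofAdd 1)})
      (Fin 4 → alternatingGroup α) (SemidirectProduct (Fin 3 → Cyc 2) (Cyc 4) ψ) := by
  have : Nonempty α := ⟨o⟩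
  obtain ⟨τ, hτ⟩ : ∃ τ : Perm α, τ.IsSwap :=
    ⟨_, o, a o, (h.left_isCycleOn.apply_ne h.left_nontrivial h.mem_left).symm, rfl⟩
  have hcard : Nat.card (Subgroup.zpowers τ) = Nat.card (Cyc 2) := by
    rw [Nat.card_zpowers, hτ.orderOf]
    simp
  -- The complement `Z₂³ ⋊ Z₄` is generated by the swap families and the shift; `ψ` is the resulting
  -- action.
  have hQ := (isSemidirectProduct_sup_shiftPerm (swapFamilies_shiftInvariant τ)).congr
    (MulEquiv.refl _) ((swapFamiliesEquiv hτ).trans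
      (MulEquiv.piCongrRight fun _ => mulEquivOfCyclicCardEq hcard)) (MulEquiv.refl (Cyc 4))
  obtain ⟨ψ, ⟨e⟩⟩ := hQ
  refine ⟨ψ, ?_⟩
  rw [closure_eq_sup (pairAt_one_mem_evenProductFamilies
      (by simp [h.sign_left, h.symm.sign_left, hs.neg_one_pow, ht.neg_one_pow]))
    fun P' h₁ h₂ => h.evenProductFamilies_le hs ht h₁ h₂,
    ← evenFamilies_sup_swapFamilies hτ, Subgroup.map_sup, sup_assoc]
  refine (IsSemidirectProduct.sup _ _ (sup_le (evenFamilies_le_normalizer _)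
    evenFamilies_shiftInvariant.range_le_normalizer) ?_).congr (MulEquiv.refl _)
    (((evenFamilies α).equivMapOfInjective _ fibrewisePerm_injective).symm.trans
      (evenFamiliesEquiv α)) e
  rw [Subgroup.disjoint_def]
  rintro _ ⟨f, hf, rfl⟩ hf'
  rw [← SetLike.mem_coe, Subgroup.coe_mul_of_right_le_normalizer_left _ _
    (swapFamilies_shiftInvariant τ).range_le_normalizer] at hf'
  obtain ⟨_, ⟨g, hg, rfl⟩, r, hr, hgr⟩ := hf'
  -- The shift component is also fibrewise, hence trivial; then `f = g` is both an even family and a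
  -- swap family.
  have hr' : r = fibrewisePerm α (g⁻¹ * f) := by
    rw [map_mul, map_inv, eq_inv_mul_iff_mul_eq]
    exact hgr
  have hr1 := Subgroup.disjoint_def.1 (disjoint_map_shiftPerm_range ⊤)
    (hr' ▸ Subgroup.mem_map_of_mem _ (Subgroup.mem_top _)) hr
  have hfg : f = g := by
    apply fibrewisePerm_injective
    rw [← hgr, hr1]
    exact (mul_one _).symm
  rw [disjoint_evenFamilies_swapFamilies hτ hf (hfg ▸ hg), map_one]

end SignProduct

/-! ### From the tree to two cycles and a shift. -/

namespace BicolouredPlaneTree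

variable {E B W : Type*} (T : BicolouredPlaneTree E B W)

theorem black_σ₀ (e : E) : T.black (T.σ₀ e) = T.black e :=
  (T.sameCycle_σ₀ _ _).1 (sameCycle_apply_left.2 (SameCycle.refl _ _))

theorem white_zpow_σ₁ (e : E) (n : ℤ) : T.white ((T.σ₁ ^ n) e) = T.white e :=
  (T.sameCycle_σ₁ _ _).1 (sameCycle_zpow_left.2 (SameCycle.refl _ _))

theorem white_σ₁ (e : E) : T.white (T.σ₁ e) = T.white e := T.white_zpow_σ₁ e 1

theorem isCycleOn_σ₀ (b : B) : T.σ₀.IsCycleOn {e | T.black e = b} :=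
  ⟨T.σ₀.bijOn fun e => by simp [black_σ₀], fun e he f hf =>
    (T.sameCycle_σ₀ e f).2 (Eq.trans he (Eq.symm hf))⟩

theorem isCycleOn_σ₁ (w : W) : T.σ₁.IsCycleOn {e | T.white e = w} :=
  ⟨T.σ₁.bijOn fun e => by simp [white_σ₁], fun e he f hf =>
    (T.sameCycle_σ₁ e f).2 (Eq.trans he (Eq.symm hf))⟩

variable {T}

theorem eq_of_ends {e f : E} (hb : T.black e = T.black f) (hw : T.white e = T.white f) : e = f :=
  T.ends_injective (Prod.ext hb hw)

theorem eq_of_blackDegree_eq_one {e f : E} (h : T.blackDegree (T.black e) = 1)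
    (hf : T.black f = T.black e) : f = e := by
  have := (Nat.card_eq_one_iff_unique.1 h).1
  exact congrArg Subtype.val (Subsingleton.elim (α := {e' // T.black e' = T.black e})
    ⟨f, hf⟩ ⟨e, rfl⟩)

/-- The set of white vertices adjacent to a black vertex. -/
def whiteNeighbours (T : BicolouredPlaneTree E B W) (b : B) : Set W :=
  {w | ∃ e, T.black e = b ∧ T.white e = w}

theorem ncard_whiteNeighbours (b : B) : (T.whiteNeighbours b).ncard = T.blackDegree b := by
  have : T.whiteNeighbours b = T.white '' {e | T.black e = b} := rfl
  have hinj : Set.InjOn T.white {e | T.black e = b} := fun e he f hf h =>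
    eq_of_ends (Eq.trans he (Eq.symm hf)) h
  rw [this, hinj.ncard_image]
  rfl

/-- Connectedness of the tree: membership in `S` propagates along walks. -/
theorem mem_of_forall_black_eq {S : Set W} (hS : ∀ e f, T.black e = T.black f → T.white e ∈ S →
    T.white f ∈ S) {w₀ : W} (h₀ : w₀ ∈ S) (w : W) : w ∈ S := by
  let Q : B ⊕ W → Prop := Sum.elim (fun b => ∃ e, T.black e = b ∧ T.white e ∈ S) (· ∈ S)
  have hQ : ∀ u v, (bicolouredGraph T.black T.white).Adj u v → Q u → Q v := by
    rintro u v (⟨e, rfl, rfl⟩ | ⟨e, rfl, rfl⟩) hu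
    · obtain ⟨f, hf, hfS⟩ := hu
      exact hS f e hf hfS
    · exact ⟨e, rfl, hu⟩
  have hwalk : ∀ u v, (bicolouredGraph T.black T.white).Walk u v → Q u → Q v := by
    intro u v p
    induction p with
    | nil => exact id
    | cons h _ ih => exact fun hu => ih (hQ _ _ h hu)
  obtain ⟨p⟩ := T.isTree.connected (Sum.inr w₀) (Sum.inr w)
  exact hwalk _ _ p h₀

/-- Two common neighbours would give two distinct paths from `x` to `y`, against acyclicity. -/
theorem eq_of_mem_whiteNeighbours {x y : B} (hxy : x ≠ y) {c d : W}
    (hcx : c ∈ T.whiteNeighbours x) (hcy : c ∈ T.whiteNeighbours y)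
    (hdx : d ∈ T.whiteNeighbours x) (hdy : d ∈ T.whiteNeighbours y) : c = d := by
  have key : ∀ c ∈ T.whiteNeighbours x, c ∈ T.whiteNeighbours y →
      ∃ p : (bicolouredGraph T.black T.white).Path (Sum.inl x) (Sum.inl y),
        p.1.support = [Sum.inl x, Sum.inr c, Sum.inl y] := by
    rintro c ⟨e, he, hec⟩ ⟨f, hf, hfc⟩
    have h₁ : (bicolouredGraph T.black T.white).Adj (Sum.inl x) (Sum.inr c) :=
      Or.inl ⟨e, by rw [he], by rw [hec]⟩
    have h₂ : (bicolouredGraph T.black T.white).Adj (Sum.inr c) (Sum.inl y) :=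
      Or.inr ⟨f, by rw [hf], by rw [hfc]⟩
    refine ⟨⟨.cons h₁ (.cons h₂ .nil), ?_⟩, by simp⟩
    rw [SimpleGraph.Walk.isPath_def]
    simp [hxy]
  obtain ⟨p, hp⟩ := key c hcx hcy
  obtain ⟨q, hq⟩ := key d hdx hdy
  have hpq : p = q := (T.isTree.isAcyclic.subsingleton_path _ _).elim p q
  rw [hpq, hq] at hp
  simpa using hp.symm

/-- Without multiple edges, edges at `b` are determined by their white ends, so the rotation at `b`
transports to `W`. -/
theorem exists_perm_white (T : BicolouredPlaneTree E B W) (b : B) :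
    ∃ a : Perm W, a.IsCycleOn (T.whiteNeighbours b) ∧ (∀ w, w ∉ T.whiteNeighbours b → a w = w) ∧
      ∀ e, T.black e = b → a (T.white e) = T.white (T.σ₀ e) := by
  classical
  let f : {e | T.black e = b} ≃ {w // w ∈ T.whiteNeighbours b} :=
    Equiv.ofBijective (fun e => ⟨T.white e, e, e.2, rfl⟩) ⟨fun e f h =>
      Subtype.ext (eq_of_ends (Eq.trans e.2 (Eq.symm f.2)) (congrArg Subtype.val h)),
      fun ⟨w, e, he, hw⟩ => ⟨⟨e, he⟩, Subtype.ext hw⟩⟩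
  have hc := (T.isCycleOn_σ₀ b).subtypePerm.extendDomain f
  have himage : (Subtype.val ∘ f) '' Set.univ = T.whiteNeighbours b := by
    ext w
    constructor
    · rintro ⟨e, -, rfl⟩
      exact (f e).2
    · rintro ⟨e, he, rfl⟩
      exact ⟨⟨e, he⟩, trivial, rfl⟩
  rw [himage] at hc
  refine ⟨_, hc, fun w hw => extendDomain_apply_not_subtype _ f hw, fun e he => ?_⟩
  exact extendDomain_apply_image _ f ⟨e, he⟩

/-- All white vertices have degree four, and the black vertices are leaves, except for `x` and `y`,
which have degree `r ≥ 2`. -/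
structure IsDoubleStar (T : BicolouredPlaneTree E B W) (r : ℕ) (x y : B) : Prop where
  two_le : 2 ≤ r
  ne : x ≠ y
  blackDegree_left : T.blackDegree x = r
  blackDegree_right : T.blackDegree y = r
  blackDegree_of_ne : ∀ b, b ≠ x → b ≠ y → T.blackDegree b = 1
  whiteDegree_eq : ∀ w, T.whiteDegree w = 4

theorem HasPassport.exists_isDoubleStar [Fintype E] [Fintype B] [Fintype W] {r s p n : ℕ}
    (hr : 2 ≤ r) (hT : T.HasPassport (Multiset.replicate 2 r + Multiset.replicate s 1)
      (Multiset.replicate p 4) n) : ∃ x y, T.IsDoubleStar r x y := by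
  classical
  obtain ⟨-, hB, hW⟩ := hT
  have hdeg : ∀ b, T.blackDegree b = r ∨ T.blackDegree b = 1 := fun b => by
    have : T.blackDegree b ∈ Multiset.replicate 2 r + Multiset.replicate s 1 := by
      rw [← hB]
      exact Multiset.mem_map_of_mem _ (Finset.mem_univ b)
    rcases Multiset.mem_add.1 this with h | h
    exacts [Or.inl (Multiset.eq_of_mem_replicate h), Or.inr (Multiset.eq_of_mem_replicate h)]
  -- As `r ≠ 1`, the ones contribute nothing, so exactly two black vertices have degree `r`.
  have hcount := congrArg (Multiset.count r) hB
  rw [Multiset.count_map, Multiset.count_add, Multiset.count_replicate_self,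
    Multiset.count_replicate, if_neg (by omega)] at hcount
  have hcard : (Finset.univ.filter fun b => r = T.blackDegree b).card = 2 := hcount
  obtain ⟨x, y, hxy, hs⟩ := Finset.card_eq_two.1 hcard
  have hmem : ∀ b, r = T.blackDegree b ↔ b = x ∨ b = y := fun b => by
    have := congrArg (b ∈ ·) hs
    simpa using this
  refine ⟨x, y, hr, hxy, ((hmem x).2 (.inl rfl)).symm, ((hmem y).2 (.inr rfl)).symm,
    fun b hx hy => (hdeg b).resolve_left fun h => ?_, fun w => ?_⟩
  · rcases (hmem b).1 h.symm with h | h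
    exacts [hx h, hy h]
  · have : T.whiteDegree w ∈ Multiset.replicate p 4 := by
      rw [← hW]
      exact Multiset.mem_map_of_mem _ (Finset.mem_univ w)
    exact Multiset.eq_of_mem_replicate this

theorem HasPassport.card_white [Fintype E] [Fintype B] [Fintype W] {α : Multiset ℕ} {p d n : ℕ}
    (hT : T.HasPassport α (Multiset.replicate p d) n) : Fintype.card W = p := by
  simpa using congrArg Multiset.card hT.2.2

namespace IsDoubleStar

variable {r : ℕ} {x y : B}

theorem symm (h : T.IsDoubleStar r x y) : T.IsDoubleStar r y x :=
  ⟨h.two_le, h.ne.symm, h.blackDegree_right, h.blackDegree_left,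
    fun b hy hx => h.blackDegree_of_ne b hx hy, h.whiteDegree_eq⟩

theorem eq_or_eq_or_leaf (h : T.IsDoubleStar r x y) (e : E) :
    T.black e = x ∨ T.black e = y ∨
      (T.black e ≠ x ∧ T.black e ≠ y ∧ T.blackDegree (T.black e) = 1) := by
  by_cases hx : T.black e = x
  · exact .inl hx
  by_cases hy : T.black e = y
  · exact .inr (.inl hy)
  exact .inr (.inr ⟨hx, hy, h.blackDegree_of_ne _ hx hy⟩)

theorem nontrivial_left (h : T.IsDoubleStar r x y) [Finite W] :
    (T.whiteNeighbours x).Nontrivial := by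
  rw [← Set.one_lt_ncard_iff_nontrivial, ncard_whiteNeighbours, h.blackDegree_left]
  exact h.two_le

theorem mem_or_mem (h : T.IsDoubleStar r x y) [Finite W] (w : W) :
    w ∈ T.whiteNeighbours x ∨ w ∈ T.whiteNeighbours y := by
  obtain ⟨w₀, h₀⟩ := h.nontrivial_left.nonempty
  refine mem_of_forall_black_eq (T := T) (S := T.whiteNeighbours x ∪ T.whiteNeighbours y)
    (fun e f hef he => ?_) (.inl h₀) w
  rcases h.eq_or_eq_or_leaf f with hf | hf | ⟨-, -, hf⟩
  · exact .inl ⟨f, hf, rfl⟩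
  · exact .inr ⟨f, hf, rfl⟩
  · rwa [← eq_of_blackDegree_eq_one hf hef]

/-- Otherwise the white neighbours of `x` are closed under passing through any black vertex, so by
connectedness they are all of `W`, including the neighbours of `y`. -/
theorem exists_common (h : T.IsDoubleStar r x y) [Finite W] :
    ∃ w, w ∈ T.whiteNeighbours x ∧ w ∈ T.whiteNeighbours y := by
  by_contra! hdisj
  obtain ⟨w₀, h₀⟩ := h.nontrivial_left.nonempty
  obtain ⟨w₁, h₁⟩ := h.symm.nontrivial_left.nonempty
  refine hdisj w₁ (mem_of_forall_black_eq (T := T) (fun e f hef he => ?_) h₀ w₁) h₁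
  rcases h.eq_or_eq_or_leaf f with hf | hf | ⟨-, -, hf⟩
  · exact ⟨f, hf, rfl⟩
  · exact absurd ⟨e, hef.trans hf, rfl⟩ (hdisj _ he)
  · rwa [← eq_of_blackDegree_eq_one hf hef]

theorem zpow_σ₁_eq_iff (h : T.IsDoubleStar r x y) [Finite E] (e : E) {m n : ℤ} :
    (T.σ₁ ^ m) e = (T.σ₁ ^ n) e ↔ (m : ZMod 4) = n := by
  have hc := T.isCycleOn_σ₁ (T.white e)
  have hcard : (Set.toFinite {f | T.white f = T.white e}).toFinset.card = 4 := by
    rw [← Set.ncard_eq_toFinset_card]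
    exact h.whiteDegree_eq _
  rw [← (Set.toFinite {f | T.white f = T.white e}).coe_toFinset] at hc
  rw [hc.zpow_apply_eq_zpow_apply (by simp), hcard, ZMod.intCast_eq_intCast_iff]

theorem exists_zpow_σ₁_eq {e f : E} (hef : T.white e = T.white f) : ∃ k : ℤ, (T.σ₁ ^ k) e = f :=
  (T.sameCycle_σ₁ e f).2 hef

theorem σ₁_pow_four (h : T.IsDoubleStar r x y) [Finite E] (e : E) : (T.σ₁ ^ 4) e = e := by
  have := (h.zpow_σ₁_eq_iff e (m := 4) (n := 0)).2 (by decide)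
  simpa using this

theorem isCenter_iff (h : T.IsDoubleStar r x y) [Finite E] {c : W} :
    T.IsCenter r c ↔ c ∈ T.whiteNeighbours x ∧ c ∈ T.whiteNeighbours y := by
  have hr := h.two_le
  have hdeg : ∀ e, T.blackDegree (T.black e) = r ↔ T.black e = x ∨ T.black e = y := fun e => by
    constructor
    · intro he
      by_contra! hne
      have := h.blackDegree_of_ne _ hne.1 hne.2
      omega
    · rintro (he | he) <;> rw [he]
      exacts [h.blackDegree_left, h.blackDegree_right]
  constructor
  · rintro ⟨-, h2, -⟩
    obtain ⟨⟨e, hec, he⟩, ⟨f, hfc, hf⟩, hne, -⟩ := Nat.card_eq_two_iff.1 h2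
    have hbne : T.black e ≠ T.black f := fun hb =>
      hne (Subtype.ext (eq_of_ends hb (hec.trans hfc.symm)))
    rcases (hdeg e).1 he with he | he <;> rcases (hdeg f).1 hf with hf | hf
    · exact absurd (he.trans hf.symm) hbne
    · exact ⟨⟨e, he, hec⟩, ⟨f, hf, hfc⟩⟩
    · exact ⟨⟨f, hf, hfc⟩, ⟨e, he, hec⟩⟩
    · exact absurd (he.trans hf.symm) hbne
  · rintro ⟨⟨e, he, hec⟩, ⟨f, hf, hfc⟩⟩
    have hef : e ≠ f := by
      rintro rfl
      exact h.ne (he.symm.trans hf)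
    have hset : {g | T.white g = c ∧ T.blackDegree (T.black g) = r} = {e, f} := by
      ext g
      constructor
      · rintro ⟨hgc, hg⟩
        rcases (hdeg g).1 hg with hg | hg
        · exact .inl (eq_of_ends (hg.trans he.symm) (hgc.trans hec.symm))
        · exact .inr (eq_of_ends (hg.trans hf.symm) (hgc.trans hfc.symm))
      · rintro (rfl | rfl)
        exacts [⟨hec, (hdeg _).2 (.inl he)⟩, ⟨hfc, (hdeg _).2 (.inr hf)⟩]
    have h2 : {g | T.white g = c ∧ T.blackDegree (T.black g) = r}.ncard = 2 := by
      rw [hset, Set.ncard_pair hef]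
    have hunion : {g | T.white g = c ∧ T.blackDegree (T.black g) = r} ∪
        {g | T.white g = c ∧ T.blackDegree (T.black g) = 1} = {g | T.white g = c} := by
      ext g
      constructor
      · rintro (hg | hg)
        exacts [hg.1, hg.1]
      · intro hg
        rcases h.eq_or_eq_or_leaf g with hx | hy | ⟨-, -, h1⟩
        exacts [.inl ⟨hg, (hdeg g).2 (.inl hx)⟩, .inl ⟨hg, (hdeg g).2 (.inr hy)⟩, .inr ⟨hg, h1⟩]
    have h4 : {g | T.white g = c}.ncard = 4 := h.whiteDegree_eq c
    have hdisj : _root_.Disjoint {g | T.white g = c ∧ T.blackDegree (T.black g) = r}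
        {g | T.white g = c ∧ T.blackDegree (T.black g) = 1} := by
      rw [Set.disjoint_left]
      rintro g ⟨-, h1⟩ ⟨-, h2⟩
      omega
    rw [← hunion, Set.ncard_union_eq hdisj, h2] at h4
    exact ⟨h.whiteDegree_eq c, h2, Nat.add_left_cancel h4⟩

/-- With the edges to `x` and `y` opposite, any two consecutive edges include one of them. -/
theorem not_hasConsecutiveLeaves (h : T.IsDoubleStar r x y) [Finite E] {e f : E}
    (he : T.black e = x) (hf : T.black f = y) (hef : (T.σ₁ ^ 2) e = f) :
    ¬ T.HasConsecutiveLeaves (T.white e) := by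
  have hr := h.two_le
  have hex : T.blackDegree (T.black e) ≠ 1 := by rw [he, h.blackDegree_left]; omega
  have hfy : T.blackDegree (T.black f) ≠ 1 := by rw [hf, h.blackDegree_right]; omega
  rintro ⟨g, hg, h1, h2⟩
  obtain ⟨k, rfl⟩ := exists_zpow_σ₁_eq hg.symm
  have d : ∀ i : ZMod 4, i = 0 ∨ i = 1 ∨ i = 2 ∨ i = 3 := by decide
  rcases d (k : ZMod 4) with hk | hk | hk | hk
  · rw [(h.zpow_σ₁_eq_iff e (n := 0)).2 (by simpa using hk)] at h1
    exact hex h1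
  · rw [(h.zpow_σ₁_eq_iff e (n := 1)).2 (by simpa using hk)] at h2
    rw [← hef, pow_two] at hfy
    exact hfy h2
  · rw [(h.zpow_σ₁_eq_iff e (n := 2)).2 (by simpa using hk)] at h1
    rw [← hef] at hfy
    exact hfy h1
  · rw [(h.zpow_σ₁_eq_iff e (n := 3)).2 (by simpa using hk)] at h2
    rw [← h.σ₁_pow_four e, pow_succ'] at hex
    exact hex h2

theorem hasConsecutiveLeaves (h : T.IsDoubleStar r x y) [Finite E] {e f : E}
    (he : T.black e = x) (hf : T.black f = y) (hef : T.σ₁ e = f) :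
    T.HasConsecutiveLeaves (T.white e) := by
  have key : ∀ n : ℤ, (n : ZMod 4) ≠ 0 → (n : ZMod 4) ≠ 1 →
      T.blackDegree (T.black ((T.σ₁ ^ n) e)) = 1 := fun n h0 h1 => by
    refine h.blackDegree_of_ne _ (fun hx => h0 ?_) fun hy => h1 ?_
    · have : (T.σ₁ ^ n) e = (T.σ₁ ^ (0 : ℤ)) e :=
        eq_of_ends (T := T) (by simpa [he] using hx) (by simp [white_zpow_σ₁])
      simpa using (h.zpow_σ₁_eq_iff e).1 this
    · have : (T.σ₁ ^ n) e = (T.σ₁ ^ (1 : ℤ)) e :=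
        eq_of_ends (T := T) (by simpa [hef, hf] using hy) (by simp [white_zpow_σ₁, white_σ₁])
      simpa using (h.zpow_σ₁_eq_iff e).1 this
  refine ⟨(T.σ₁ ^ (2 : ℤ)) e, T.white_zpow_σ₁ _ _, key 2 (by decide) (by decide), ?_⟩
  rw [← Perm.mul_apply, ← zpow_one_add]
  exact key _ (by decide) (by decide)

/-- The edges are parametrized by their white end and their position around it, counted so that the
edges at `x` have position `0` and the edges at `y` have position `k`. -/
theorem exists_coordinates (h : T.IsDoubleStar r x y) [Finite E] [Finite W] {e f : E}
    (he : T.black e = x) (hf : T.black f = y) {k : ℤ} (hef : (T.σ₁ ^ k) e = f) :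
    ∃ Φ : E ≃ W × ZMod 4, (∀ g, (Φ g).1 = T.white g) ∧
      (∀ g, Φ (T.σ₁ g) = ((Φ g).1, (Φ g).2 + 1)) ∧
      (∀ g, T.black g = x → (Φ g).2 = 0) ∧ (∀ g, T.black g = y → (Φ g).2 = k) := by
  -- The origin at `w` is its edge to `x` if there is one, otherwise its edge to `y` turned back by
  -- `k`. Both prescriptions apply only at the center, where `hef` makes them agree.
  have hbase : ∀ w, ∃ g, T.white g = w ∧ (∀ g', T.white g' = w → T.black g' = x → g' = g) ∧
      ∀ g', T.white g' = w → T.black g' = y → g' = (T.σ₁ ^ k) g := fun w => by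
    by_cases hw : w ∈ T.whiteNeighbours x
    · obtain ⟨g, hg, rfl⟩ := hw
      refine ⟨g, rfl, fun g' h₁ h₂ => eq_of_ends (h₂.trans hg.symm) h₁, fun g' h₁ h₂ => ?_⟩
      have hew : T.white g = T.white e := eq_of_mem_whiteNeighbours h.ne ⟨g, hg, rfl⟩
        ⟨g', h₂, h₁⟩ ⟨e, he, rfl⟩ ⟨f, hf, by rw [← hef, white_zpow_σ₁]⟩
      have hge : g = e := eq_of_ends (hg.trans he.symm) hew
      rw [hge, hef]
      exact eq_of_ends (h₂.trans hf.symm) (by rw [h₁, hew, ← hef, white_zpow_σ₁])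
    · obtain ⟨g, hg, rfl⟩ := (h.mem_or_mem w).resolve_left hw
      refine ⟨(T.σ₁ ^ (-k)) g, T.white_zpow_σ₁ _ _, fun g' h₁ h₂ => absurd ⟨g', h₂, h₁⟩ hw,
        fun g' h₁ h₂ => ?_⟩
      rw [← Perm.mul_apply, ← zpow_add]
      simpa using eq_of_ends (h₂.trans hg.symm) h₁
  choose β hβw hβx hβy using hbase
  let Ψ : W × ZMod 4 → E := fun u => (T.σ₁ ^ (u.2.val : ℤ)) (β u.1)
  have hΨw : ∀ u, T.white (Ψ u) = u.1 := fun u => by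
    simp only [Ψ]
    rw [white_zpow_σ₁, hβw]
  have hΨ : ∀ w (n : ℤ), Ψ (w, n) = (T.σ₁ ^ n) (β w) := fun w n =>
    (h.zpow_σ₁_eq_iff (β w)).2 (by simp)
  have hbij : Function.Bijective Ψ := by
    refine ⟨fun u v huv => ?_, fun g => ?_⟩
    · have h1 : u.1 = v.1 := by rw [← hΨw u, huv, hΨw]
      refine Prod.ext h1 ?_
      simp only [Ψ, h1] at huv
      simpa using (h.zpow_σ₁_eq_iff (β v.1)).1 huv
    · obtain ⟨n, hn⟩ := exists_zpow_σ₁_eq (hβw (T.white g))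
      exact ⟨(T.white g, n), by rw [hΨ, hn]⟩
  let Φ : E ≃ W × ZMod 4 := (Equiv.ofBijective Ψ hbij).symm
  have hΦ : ∀ g u, Ψ u = g → Φ g = u := fun g u hu => by
    rw [Equiv.symm_apply_eq]
    exact hu.symm
  have hΦ' : ∀ g, Ψ (Φ g) = g := fun g => (Equiv.ofBijective Ψ hbij).apply_symm_apply g
  refine ⟨Φ, fun g => by rw [← hΨw, hΦ'], fun g => hΦ _ _ ?_, fun g hg => ?_, fun g hg => ?_⟩
  · obtain ⟨n, hn⟩ := ZMod.intCast_surjective (Φ g).2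
    have h1 := hΨ (Φ g).1 n
    rw [hn, Prod.mk.eta, hΦ'] at h1
    have h2 := hΨ (Φ g).1 (1 + n)
    rw [Int.cast_add, Int.cast_one, hn, add_comm, zpow_one_add, Perm.mul_apply, ← h1] at h2
    exact h2
  · rw [hΦ g (T.white g, ((0 : ℤ) : ZMod 4)) (by
      rw [hΨ, ← hβx _ g rfl hg, zpow_zero, Perm.one_apply])]
    simp
  · rw [hΦ g (T.white g, ((k : ℤ) : ZMod 4)) (by rw [hΨ, ← hβy _ g rfl hg])]

/-- The monodromy group is generated by the fibrewise action of two cycles meeting in one point and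
by the shift. -/
theorem exists_cyclesMeetingAt (h : T.IsDoubleStar r x y) [Finite E] [Finite W] {e f : E}
    (he : T.black e = x) (hf : T.black f = y) {k : ℤ} (hef : (T.σ₁ ^ k) e = f) :
    ∃ (a b : Perm W) (s t : Set W), CyclesMeetingAt a b s t (T.white e) ∧ s.ncard = r ∧
      t.ncard = r ∧ Nonempty (Subgroup.closure {fibrewisePerm W (pairAt k a b),
        shiftPerm W (Multiplicative.ofAdd 1)} ≃* T.monodromyGroup) := by
  obtain ⟨a, ha, ha', haσ⟩ := T.exists_perm_white x
  obtain ⟨b, hb, hb', hbσ⟩ := T.exists_perm_white y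
  have hwf : T.white f = T.white e := by rw [← hef, white_zpow_σ₁]
  refine ⟨a, b, _, _, ⟨ha, hb, ha', hb', h.mem_or_mem, ⟨e, he, rfl⟩, ⟨f, hf, hwf⟩,
    fun w hx hy => eq_of_mem_whiteNeighbours h.ne hx hy ⟨e, he, rfl⟩ ⟨f, hf, hwf⟩,
    h.nontrivial_left, h.symm.nontrivial_left⟩,
    ncard_whiteNeighbours x ▸ h.blackDegree_left, ncard_whiteNeighbours y ▸ h.blackDegree_right,
    ?_⟩
  obtain ⟨Φ, hΦw, hΦσ, hΦx, hΦy⟩ := h.exists_coordinates he hf hef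
  have hk : (k : ZMod 4) ≠ 0 := fun hk => h.ne (by
    have := (h.zpow_σ₁_eq_iff e (m := k) (n := 0)).2 (by simpa using hk)
    rw [hef] at this
    rw [← he, ← hf, this]
    simp)
  have h₁ : Φ.permCongrHom T.σ₁ = shiftPerm W (Multiplicative.ofAdd 1) := by
    ext1 u
    obtain ⟨g, rfl⟩ := Φ.surjective u
    simp [Equiv.permCongr_apply, hΦσ]
  have h₀ : Φ.permCongrHom T.σ₀ = fibrewisePerm W (pairAt k a b) := by
    ext1 u
    obtain ⟨g, rfl⟩ := Φ.surjective u
    rw [Equiv.permCongrHom_coe, Equiv.permCongr_apply, Equiv.symm_apply_apply,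
      fibrewisePerm_apply]
    rcases h.eq_or_eq_or_leaf g with hg | hg | ⟨hgx, hgy, hg⟩
    · refine Prod.ext ?_ ?_
      · rw [hΦw, hΦx g hg, hΦw, pairAt, if_pos rfl, haσ g hg]
      · rw [hΦx _ ((T.black_σ₀ g).trans hg), hΦx g hg]
    · refine Prod.ext ?_ ?_
      · rw [hΦw, hΦy g hg, hΦw, pairAt, if_neg hk, if_pos rfl, hbσ g hg]
      · rw [hΦy _ ((T.black_σ₀ g).trans hg), hΦy g hg]
    -- A leaf edge in position `0` (or `k`) has a white end not adjacent to `x` (or `y`), since the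
    -- edge to `x` (or `y`) would occupy the same place; so `a` (or `b`) fixes that end.
    · rw [eq_of_blackDegree_eq_one hg (T.black_σ₀ g)]
      refine Prod.ext ?_ rfl
      rw [pairAt]
      split_ifs with hg0 hgk
      · refine (ha' _ ?_).symm
        rintro ⟨g', hg', hw⟩
        refine hgx (Eq.trans (congrArg T.black (Φ.injective (Prod.ext ?_ ?_))) hg')
        · rw [hΦw g', hw]
        · rw [hΦx g' hg', hg0]
      · refine (hb' _ ?_).symm
        rintro ⟨g', hg', hw⟩
        refine hgy (Eq.trans (congrArg T.black (Φ.injective (Prod.ext ?_ ?_))) hg')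
        · rw [hΦw g', hw]
        · rw [hΦy g' hg', hgk]
      · rfl
  have hmap : T.monodromyGroup.map Φ.permCongrHom.toMonoidHom =
      Subgroup.closure {fibrewisePerm W (pairAt k a b), shiftPerm W (Multiplicative.ofAdd 1)} := by
    rw [monodromyGroup, MonoidHom.map_closure, Set.image_pair]
    exact congrArg₂ (fun u v => Subgroup.closure {u, v}) h₀ h₁
  exact ⟨((Φ.permCongrHom.subgroupMap T.monodromyGroup).trans
    (MulEquiv.subgroupCongr hmap)).symm⟩

theorem isSemidirectProduct_of_pow_two (h : T.IsDoubleStar r x y) [Finite E] [Fintype W] {p : ℕ}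
    (hp : Fintype.card W = p) {e f : E} (he : T.black e = x) (hf : T.black f = y)
    (hef : (T.σ₁ ^ (2 : ℤ)) e = f) :
    (Odd r → IsSemidirectProduct T.monodromyGroup (Fin 2 → Alt p) (Cyc 4)) ∧
      (Even r → IsSemidirectProduct T.monodromyGroup (Fin 2 → Symm p) (Cyc 4)) := by
  classical
  obtain ⟨a, b, s, t, hc, hs, ht, ⟨φ⟩⟩ := h.exists_cyclesMeetingAt he hf hef
  have hG := hc.isSemidirectProduct_closure_pairAt_two (hs.trans ht.symm)
  let ε : W ≃ Fin p := Fintype.equivFinOfCardEq hp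
  constructor
  · intro hr
    have hH := hc.closure_eq_alternatingGroup (hs ▸ hr) (ht ▸ hr)
    exact hG.congr φ (MulEquiv.piCongrRight fun _ =>
      (MulEquiv.subgroupCongr hH).trans ε.altCongrHom) (MulEquiv.refl _)
  · intro hr
    have hH := hc.closure_eq_top (hs ▸ hr)
    exact hG.congr φ (MulEquiv.piCongrRight fun _ =>
      ((MulEquiv.subgroupCongr hH).trans Subgroup.topEquiv).trans ε.permCongrHom) (MulEquiv.refl _)

theorem isSemidirectProduct_of_apply (h : T.IsDoubleStar r x y) [Finite E] [Fintype W] {p : ℕ}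
    (hp : Fintype.card W = p) {e f : E} (he : T.black e = x) (hf : T.black f = y)
    (hef : (T.σ₁ ^ (1 : ℤ)) e = f) :
    (Odd r → IsSemidirectProduct T.monodromyGroup (Fin 4 → Alt p) (Cyc 4)) ∧
      (Even r → ∃ ψ : Cyc 4 →* MulAut (Fin 3 → Cyc 2),
        IsSemidirectProduct T.monodromyGroup (Fin 4 → Alt p)
          (SemidirectProduct (Fin 3 → Cyc 2) (Cyc 4) ψ)) := by
  classical
  obtain ⟨a, b, s, t, hc, hs, ht, ⟨φ⟩⟩ := h.exists_cyclesMeetingAt he hf hef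
  rw [Int.cast_one] at φ
  let ε : W ≃ Fin p := Fintype.equivFinOfCardEq hp
  constructor
  · intro hr
    exact (hc.isSemidirectProduct_closure_pairAt_one_of_odd (hs ▸ hr) (ht ▸ hr)).congr φ
      (MulEquiv.piCongrRight fun _ => ε.altCongrHom) (MulEquiv.refl _)
  · intro hr
    obtain ⟨ψ, hψ⟩ := hc.isSemidirectProduct_closure_pairAt_one_of_even (hs ▸ hr) (ht ▸ hr)
    exact ⟨ψ, hψ.congr φ (MulEquiv.piCongrRight fun _ => ε.altCongrHom) (MulEquiv.refl _)⟩

end IsDoubleStar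

end BicolouredPlaneTree

/-! ### Case analysis on the offset of the two large neighbours around the center. -/

theorem mainTheorem6 {E B W : Type*} [Fintype E] [Fintype B] [Fintype W]
    (r s p n : ℕ) (hr : 2 ≤ r) (T : BicolouredPlaneTree E B W)
    (hT : T.HasPassport (Multiset.replicate 2 r + Multiset.replicate s 1)
      (Multiset.replicate p 4) n) :
    (∃! c, T.IsCenter r c) ∧
    ∀ c, T.IsCenter r c →
      (¬ T.HasConsecutiveLeaves c →
        (Odd r → IsSemidirectProduct T.monodromyGroup (Fin 2 → Alt p) (Cyc 4)) ∧
        (Even r → IsSemidirectProduct T.monodromyGroup (Fin 2 → Symm p) (Cyc 4))) ∧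
      (T.HasConsecutiveLeaves c →
        (Odd r → IsSemidirectProduct T.monodromyGroup (Fin 4 → Alt p) (Cyc 4)) ∧
        (Even r → ∃ ψ : Cyc 4 →* MulAut (Fin 3 → Cyc 2),
          IsSemidirectProduct T.monodromyGroup (Fin 4 → Alt p)
            (SemidirectProduct (Fin 3 → Cyc 2) (Cyc 4) ψ))) := by
  obtain ⟨x, y, h⟩ := hT.exists_isDoubleStar hr
  have hp := hT.card_white
  constructor
  · obtain ⟨c, hcx, hcy⟩ := h.exists_common
    refine ⟨c, h.isCenter_iff.2 ⟨hcx, hcy⟩, fun d hd => ?_⟩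
    obtain ⟨hdx, hdy⟩ := h.isCenter_iff.1 hd
    exact BicolouredPlaneTree.eq_of_mem_whiteNeighbours h.ne hdx hdy hcx hcy
  intro c hc
  obtain ⟨⟨e, he, rfl⟩, ⟨f, hf, hfe⟩⟩ := h.isCenter_iff.1 hc
  obtain ⟨k, hk⟩ := BicolouredPlaneTree.IsDoubleStar.exists_zpow_σ₁_eq hfe.symm
  have hcases : ∀ i : ZMod 4, i = 0 ∨ i = 1 ∨ i = 2 ∨ i = 3 := by decide
  rcases hcases (k : ZMod 4) with hk' | hk' | hk' | hk'
  · rw [(h.zpow_σ₁_eq_iff e (n := 0)).2 (by simpa using hk')] at hk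
    exact absurd (by rw [← he, ← hf, ← hk]; simp) h.ne
  · rw [(h.zpow_σ₁_eq_iff e (n := 1)).2 (by simpa using hk')] at hk
    exact ⟨fun hn => absurd (h.hasConsecutiveLeaves he hf (by simpa using hk)) hn,
      fun _ => h.isSemidirectProduct_of_apply hp he hf hk⟩
  · rw [(h.zpow_σ₁_eq_iff e (n := 2)).2 (by simpa using hk')] at hk
    exact ⟨fun _ => h.isSemidirectProduct_of_pow_two hp he hf hk,
      fun hn => absurd hn (h.not_hasConsecutiveLeaves he hf hk)⟩
  -- Three steps from `e` to `f` is one step from `f` to `e`: exchange `x` and `y`.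
  · rw [(h.zpow_σ₁_eq_iff e (n := 3)).2 (by simpa using hk')] at hk
    have hfe' : (T.σ₁ ^ (1 : ℤ)) f = e := by
      rw [← hk, ← Equiv.Perm.mul_apply, ← zpow_add]
      exact h.σ₁_pow_four e
    refine ⟨fun hn => absurd (h.symm.hasConsecutiveLeaves hf he (by simpa using hfe')) ?_,
      fun _ => h.symm.isSemidirectProduct_of_apply hp hf he hfe'⟩
    rwa [hfe]
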